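/- **Setting.** Let $\pi\colon E\to M$ be a smooth bundle with $\dim M=m\ge 1$ and $\dim E=m+n$ (it suffices that $\pi$ is a surjection and that $E$ has an atlas of charts $(x^i,u^\alpha)$ in which $(x^i)$ is a smooth chart of $M$ composed with $\pi$). Let $\Lambda^m_2(T^*E)$ (respectively $\Lambda^m_1(T^*E)$) be the bundle over $E$ of those $m$-covectors of $E$ that vanish whenever two (respectively one) of their arguments are $\pi$-vertical. Put $J^1\pi^*=\Lambda^m_2(T^*E)/\Lambda^m_1(T^*E)$, with the quotient map $\mu\colon\Lambda^m_2(T^*E)\to J^1\pi^*$ and the projections $\pi_E^r\colon J^1\pi^*\to E$ and $\bar\pi_E^r=\pi\circ\pi_E^r\colon J^1\pi^*\to M$. Let $\Theta$ be the tautological (Liouville) $m$-form on $\Lambda^m_2(T^*E)$, let $h\colon J^1\pi^*\to\Lambda^m_2(T^*E)$ be a Hamiltonian section, i.e. a smooth section of $\mu$, and put $\Omega_h=-\mathrm d(h^*\Theta)$. For a distribution $D$ on the total space of $f\colon P\to M$, an integral section of $D$ over $N\subseteq M$ is a smooth section $\sigma$ of $f$ on an open neighbourhood of $N$ with $\operatorname{Im}(T_x\sigma)=D_{\sigma(x)}$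 for all $x$ there (only its restriction to $N$ matters). A distribution transverse to $f$ is called integrable if an integral section passes through each point of $P$. Let $\mathcal D_h$ be a solution of the Hamiltonian problem: a smooth, rank-$m$, integrable distribution on $J^1\pi^*$, transverse to $\bar\pi_E^r$, all of whose (local) integral sections $\psi$ satisfy $\psi^*(i(X)\Omega_h)=0$ for every smooth vector field $X$ on $J^1\pi^*$. For a smooth section $s$ of $\pi_E^r$ let $\mathcal D=T\pi_E^r(\mathcal D_h|_{\operatorname{Im}(s)})$ be the distribution $\mathcal D_u=T_{s(u)}\pi_E^r(\mathcal D_{h,s(u)})$ on $E$. * $s$ *solves the generalized Hamiltonian Hamilton–Jacobi problem* if $\mathcal D$ is integrable and $s\circ\gamma$ is an integral section of $\mathcal D_h$ for every integral section $\gamma$ of $\mathcal D$ over an open subset of $M$. It *solves the Hamiltonian Hamilton–Jacobi problem* if, moreover, $s^*\Omega_h=0$. * $\operatorname{Im}(s)$ is *$m$-Lagrangian* if at each of its points its tangent space $F$ equals $F^{\perp,m}=\{w : \Omega_h(w,v_1,\dots,v_m)=0\ \text{for all } v_1,\dots,v_m\in F\}$. $\mathcal D_h$ is *tangent* to $\operatorname{Im}(s)$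 if $\mathcal D_{h,s(u)}\subseteq T_{s(u)}\operatorname{Im}(s)$ for all $u\in E$. * A *domain with boundary* is a connected set $N\subseteq M$ with $\partial N:=N\setminus\operatorname{int}N\neq\emptyset$ that near each point $x$ of $\partial N$ has the form $\{g\le 0\}$ with $g$ smooth, $g(x)=0$ and $\mathrm d g(x)\neq 0$. An integral section $\psi$ of $\mathcal D_h$ over $N$ has *boundary conditions in $\operatorname{Im}(s)$* if $\psi(\partial N)\subseteq\operatorname{Im}(s)$. **Proposition.** Let $s$ be a smooth section of $\pi_E^r$ with $s^*\Omega_h=0$. The following are equivalent: 1. $s$ solves the Hamiltonian Hamilton–Jacobi problem. 2. $\operatorname{Im}(s)$ is $m$-Lagrangian for $\Omega_h$ and $\mathcal D_h$ is tangent to it. 3. The distribution $\mathcal D$ is integrable, and the integral sections of $\mathcal D_h$ with boundary conditions in $\operatorname{Im}(s)$ project onto the integral sections of $\mathcal D$: for every domain $N$ with boundary, $\pi_E^r\circ\psi$ is an integral section of $\mathcal D$ over $N$ whenever $\psi$ is an integral section of $\mathcal D_h$ over $N$ with boundary conditions in $\operatorname{Im}(s)$, and every integral section of $\mathcal D$ over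 $N$ agrees on $N$ with $\pi_E^r\circ\psi$ for some such $\psi$. -/

import Mathlib

open scoped Manifold ContDiff Topology
open Set

namespace HJ

noncomputable section

/-! ### Linear algebra of the model fibres -/

/-- Model of the base manifold, `ℝᵐ` (coordinates `xⁱ`). -/
abbrev BaseModel (m : ℕ) : Type := EuclideanSpace ℝ (Fin m)

/-- Model of the fibres, `ℝⁿ` (coordinates `uᵅ`). -/
abbrev FibreModel (n : ℕ) : Type := EuclideanSpace ℝ (Fin n)

/-- Model of the total space of a bundle with adapted coordinates `(xⁱ, uᵅ)`.
The vertical vectors of the model are those with vanishing first component. -/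
abbrev TotModel (m n : ℕ) : Type := BaseModel m × FibreModel n

/-- The alternating `m`-forms which vanish when two of their arguments are vertical
(the model fibre of `Λᵐ₂(T*E)`). -/
def semibasicTwo (m n : ℕ) : Submodule ℝ ((TotModel m n) [⋀^Fin m]→L[ℝ] ℝ) where
  carrier := {τ | ∀ (v : Fin m → TotModel m n) (i j : Fin m), i ≠ j →
    (v i).1 = 0 → (v j).1 = 0 → τ v = 0}
  add_mem' := by
    intro a b ha hb v i j hij hi hj
    simp [ha v i j hij hi hj, hb v i j hij hi hj]
  zero_mem' := by
    intro v i j _ _ _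
    simp
  smul_mem' := by
    intro c a ha v i j hij hi hj
    simp [ha v i j hij hi hj]

/-- Model fibre of the extended dual jet bundle: the space `semibasicTwo`. -/
def ExtFibre (m n : ℕ) : Type := semibasicTwo m n

instance normedAddCommGroup_extFibre (m n : ℕ) : NormedAddCommGroup (ExtFibre m n) :=
  Submodule.normedAddCommGroup (semibasicTwo m n)

instance normedSpace_extFibre (m n : ℕ) : NormedSpace ℝ (ExtFibre m n) :=
  Submodule.normedSpace (semibasicTwo m n)

/-- The inclusion of `semibasicTwo` in the space of all alternating `m`-forms. -/
def inclForm (m n : ℕ) : ExtFibre m n →ₗᵢ[ℝ] (TotModel m n) [⋀^Fin m]→L[ℝ] ℝ :=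
  (semibasicTwo m n).subtypeₗᵢ

/-- The alternating `m`-forms which vanish when one of their arguments is vertical
(the model fibre of `Λᵐ₁(T*E)`), as a subspace of `semibasicTwo`. -/
def semibasicOne (m n : ℕ) : Submodule ℝ (ExtFibre m n) where
  carrier := {τ | ∀ (v : Fin m → TotModel m n) (i : Fin m), (v i).1 = 0 → inclForm m n τ v = 0}
  add_mem' := by
    intro a b ha hb v i hi
    simp [ha v i hi, hb v i hi]
  zero_mem' := by
    intro v i _
    simp
  smul_mem' := by
    intro c a ha v i hi
    simp [ha v i hi]

instance isClosed_semibasicOne (m n : ℕ) :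
    IsClosed (semibasicOne m n : Set (ExtFibre m n)) := by
  have : (semibasicOne m n : Set (ExtFibre m n)) =
      ⋂ (v : Fin m → TotModel m n) (i : Fin m) (_ : (v i).1 = 0),
        {τ : ExtFibre m n | inclForm m n τ v = 0} := by
    ext τ
    simp only [mem_iInter]
    rfl
  rw [this]
  refine isClosed_iInter fun v => isClosed_iInter fun i => isClosed_iInter fun _ => ?_
  refine isClosed_eq ?_ continuous_const
  exact (ContinuousAlternatingMap.apply ℝ (TotModel m n) ℝ v).continuous.comp
    (inclForm m n).continuous

/-- Model fibre of the restricted (reduced) dual jet bundle: `Λᵐ₂ / Λᵐ₁`. -/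
def ResFibre (m n : ℕ) : Type := ExtFibre m n ⧸ semibasicOne m n

instance normedAddCommGroup_resFibre (m n : ℕ) : NormedAddCommGroup (ResFibre m n) :=
  Submodule.Quotient.normedAddCommGroup (semibasicOne m n)

instance normedSpace_resFibre (m n : ℕ) : NormedSpace ℝ (ResFibre m n) :=
  Submodule.Quotient.normedSpace (semibasicOne m n) ℝ

/-- The quotient map `Λᵐ₂ → Λᵐ₂ / Λᵐ₁` of the model fibres. -/
def resMk (m n : ℕ) : ExtFibre m n →L[ℝ] ResFibre m n :=
  Submodule.mkQL (semibasicOne m n)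

theorem resMk_surjective (m n : ℕ) : Function.Surjective (resMk m n) :=
  Submodule.Quotient.mk_surjective (semibasicOne m n)

variable {m n : ℕ}

/-- A linear map of the model which maps vertical vectors to vertical vectors. -/
def PreservesVertical (A : TotModel m n →L[ℝ] TotModel m n) : Prop :=
  ∀ v : FibreModel n, (A (0, v)).1 = 0

/-- Replace by zero the block of `A` which maps vertical to horizontal directions. This does nothing
to maps that preserve vertical vectors (`lowerTri_eq`), which are the only ones that matter. -/
def lowerTri : (TotModel m n →L[ℝ] TotModel m n) →L[ℝ] (TotModel m n →L[ℝ] TotModel m n) :=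
  ContinuousLinearMap.id ℝ _ -
    (ContinuousLinearMap.compL ℝ (TotModel m n) (BaseModel m) (TotModel m n)
        (ContinuousLinearMap.inl ℝ (BaseModel m) (FibreModel n))).comp
      ((ContinuousLinearMap.compL ℝ (TotModel m n) (TotModel m n) (BaseModel m)
          (ContinuousLinearMap.fst ℝ (BaseModel m) (FibreModel n))).comp
        ((ContinuousLinearMap.compL ℝ (TotModel m n) (TotModel m n) (TotModel m n)).flip
          ((ContinuousLinearMap.inr ℝ (BaseModel m) (FibreModel n)).comp
            (ContinuousLinearMap.snd ℝ (BaseModel m) (FibreModel n)))))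

theorem lowerTri_apply (A : TotModel m n →L[ℝ] TotModel m n) (w : TotModel m n) :
    lowerTri A w = A w - ((A (0, w.2)).1, 0) := by
  simp [lowerTri]

theorem lowerTri_vertical (A : TotModel m n →L[ℝ] TotModel m n) {w : TotModel m n}
    (hw : w.1 = 0) : (lowerTri A w).1 = 0 := by
  obtain ⟨x, v⟩ := w
  simp only at hw
  subst hw
  simp [lowerTri_apply]

theorem lowerTri_eq {A : TotModel m n →L[ℝ] TotModel m n} (hA : PreservesVertical A) :
    lowerTri A = A := by
  refine ContinuousLinearMap.ext fun w => ?_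
  rw [lowerTri_apply, hA w.2]
  simp

/-- Pull-back of forms in `Λᵐ₂` by a vertical-preserving linear map. -/
def pullExt (A : TotModel m n →L[ℝ] TotModel m n) : ExtFibre m n →L[ℝ] ExtFibre m n :=
  ((ContinuousAlternatingMap.compContinuousLinearMapCLM (lowerTri A)).comp
    (inclForm m n).toContinuousLinearMap).codRestrict (semibasicTwo m n) (by
      intro τ v i j hij hi hj
      exact τ.2 _ i j hij (lowerTri_vertical A hi) (lowerTri_vertical A hj))

theorem pullExt_coe (A : TotModel m n →L[ℝ] TotModel m n) (τ : ExtFibre m n) :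
    inclForm m n (pullExt A τ) = (inclForm m n τ).compContinuousLinearMap (lowerTri A) := rfl

theorem pullExt_mem_one (A : TotModel m n →L[ℝ] TotModel m n) (τ : ExtFibre m n)
    (hτ : τ ∈ semibasicOne m n) : pullExt A τ ∈ semibasicOne m n := by
  intro v i hi
  exact hτ _ i (lowerTri_vertical A hi)

/-- The induced map on classes in `Λᵐ₂ / Λᵐ₁`. -/
def pullRes (A : TotModel m n →L[ℝ] TotModel m n) : ResFibre m n →L[ℝ] ResFibre m n :=
  Submodule.liftQL (semibasicOne m n) ((resMk m n).comp (pullExt A)) (by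
    intro τ hτ
    exact (Submodule.Quotient.mk_eq_zero (semibasicOne m n)).2 (pullExt_mem_one A τ hτ))

theorem pullRes_mk (A : TotModel m n →L[ℝ] TotModel m n) (τ : ExtFibre m n) :
    pullRes A (resMk m n τ) = resMk m n (pullExt A τ) := rfl

theorem pullExt_id : pullExt (ContinuousLinearMap.id ℝ (TotModel m n)) =
    ContinuousLinearMap.id ℝ (ExtFibre m n) := by
  have h : PreservesVertical (ContinuousLinearMap.id ℝ (TotModel m n)) := fun v => rfl
  refine ContinuousLinearMap.ext fun τ => (inclForm m n).injective ?_
  rw [pullExt_coe, lowerTri_eq h]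
  rfl

theorem pullExt_comp {A B : TotModel m n →L[ℝ] TotModel m n} (hA : PreservesVertical A)
    (hB : PreservesVertical B) : (pullExt A).comp (pullExt B) = pullExt (B.comp A) := by
  have hBA : PreservesVertical (B.comp A) := by
    intro v
    have h : A (0, v) = (0, (A (0, v)).2) := Prod.ext (hA v) rfl
    rw [ContinuousLinearMap.comp_apply, h]
    exact hB _
  refine ContinuousLinearMap.ext fun τ => (inclForm m n).injective ?_
  rw [ContinuousLinearMap.comp_apply, pullExt_coe, pullExt_coe, pullExt_coe, lowerTri_eq hA,
    lowerTri_eq hB, lowerTri_eq hBA]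
  rfl

theorem pullRes_id : pullRes (ContinuousLinearMap.id ℝ (TotModel m n)) =
    ContinuousLinearMap.id ℝ (ResFibre m n) := by
  refine ContinuousLinearMap.ext fun q => ?_
  obtain ⟨τ, rfl⟩ := resMk_surjective m n q
  rw [pullRes_mk, pullExt_id]
  rfl

theorem pullRes_comp {A B : TotModel m n →L[ℝ] TotModel m n} (hA : PreservesVertical A)
    (hB : PreservesVertical B) : (pullRes A).comp (pullRes B) = pullRes (B.comp A) := by
  refine ContinuousLinearMap.ext fun q => ?_
  obtain ⟨τ, rfl⟩ := resMk_surjective m n q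
  rw [ContinuousLinearMap.comp_apply, pullRes_mk, pullRes_mk, pullRes_mk, ← pullExt_comp hA hB]
  rfl

instance finiteDimensional_forms (m n : ℕ) :
    FiniteDimensional ℝ ((TotModel m n) [⋀^Fin m]→L[ℝ] ℝ) := by
  let f : ((TotModel m n) [⋀^Fin m]→L[ℝ] ℝ) →ₗ[ℝ]
      MultilinearMap ℝ (fun _ : Fin m => TotModel m n) ℝ :=
    { toFun := fun τ => τ.toMultilinearMap
      map_add' := fun _ _ => rfl
      map_smul' := fun _ _ => rfl }
  refine FiniteDimensional.of_injective f ?_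
  intro a b hab
  ext v
  exact congrArg (fun g : MultilinearMap ℝ (fun _ : Fin m => TotModel m n) ℝ => g v) hab

instance finiteDimensional_extFibre (m n : ℕ) : FiniteDimensional ℝ (ExtFibre m n) :=
  FiniteDimensional.of_injective (inclForm m n).toLinearMap (inclForm m n).injective

instance finiteDimensional_resFibre (m n : ℕ) : FiniteDimensional ℝ (ResFibre m n) :=
  Module.Finite.of_surjective (resMk m n).toLinearMap (resMk_surjective m n)

theorem contDiff_of_comp_injective {X A B : Type*} [NormedAddCommGroup X] [NormedSpace ℝ X]
    [NormedAddCommGroup A] [NormedSpace ℝ A] [NormedAddCommGroup B] [NormedSpace ℝ B]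
    [FiniteDimensional ℝ B] (L : A →ₗ[ℝ] B) (hL : Function.Injective L) {f : X → A}
    (hf : ContDiff ℝ ∞ fun x => L (f x)) : ContDiff ℝ ∞ f := by
  obtain ⟨R, hR⟩ := L.exists_leftInverse_of_injective (LinearMap.ker_eq_bot.2 hL)
  have h := R.toContinuousLinearMap.contDiff.comp hf
  have h2 : (R.toContinuousLinearMap ∘ fun x => L (f x)) = f := by
    funext x
    exact LinearMap.congr_fun hR (f x)
  rwa [h2] at h

theorem contDiff_pullExt : ContDiff ℝ ∞ (pullExt (m := m) (n := n)) := by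
  rw [contDiff_clm_apply_iff]
  intro τ
  refine contDiff_of_comp_injective (inclForm m n).toLinearMap (inclForm m n).injective ?_
  have hfin : FiniteDimensional ℝ
      (ContinuousMultilinearMap ℝ (fun _ : Fin m => TotModel m n) ℝ) :=
    FiniteDimensional.of_injective
      ({ toFun := fun τ => τ.toMultilinearMap
         map_add' := fun _ _ => rfl
         map_smul' := fun _ _ => rfl } :
        ContinuousMultilinearMap ℝ (fun _ : Fin m => TotModel m n) ℝ →ₗ[ℝ]
          MultilinearMap ℝ (fun _ : Fin m => TotModel m n) ℝ)
      ContinuousMultilinearMap.toMultilinearMap_injective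
  refine contDiff_of_comp_injective
    (ContinuousAlternatingMap.toContinuousMultilinearMapLI (𝕜 := ℝ) (E := TotModel m n)
      (F := ℝ) (ι := Fin m)).toLinearMap
    (ContinuousAlternatingMap.toContinuousMultilinearMapLI (𝕜 := ℝ) (E := TotModel m n)
      (F := ℝ) (ι := Fin m)).injective ?_
  have h : ContDiff ℝ ∞ fun f : Fin m → (TotModel m n →L[ℝ] TotModel m n) =>
      (inclForm m n τ).toContinuousMultilinearMap.compContinuousLinearMap f := by
    exact (ContinuousMultilinearMap.contDiff
      (ContinuousMultilinearMap.compContinuousLinearMapContinuousMultilinear ℝ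
        (fun _ : Fin m => TotModel m n) (fun _ : Fin m => TotModel m n) ℝ)).clm_apply
      contDiff_const
  exact h.comp (contDiff_pi.2 fun _ => (lowerTri (m := m) (n := n)).contDiff)

theorem contDiff_pullRes : ContDiff ℝ ∞ (pullRes (m := m) (n := n)) := by
  rw [contDiff_clm_apply_iff]
  intro q
  obtain ⟨τ, rfl⟩ := resMk_surjective m n q
  exact (resMk m n).contDiff.comp (contDiff_pullExt.clm_apply contDiff_const)

/-! ### Bundles `π : E → M` and the dual jet bundles -/

section Bundles

variable (m n)

/-- `π : E → M` is a bundle of rank `n` over an `m`-dimensional manifold, presented by an atlas of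
charts `(xⁱ, uᵅ)` of `E` that are adapted to `π`: the component `(xⁱ)` of each of these charts is a
smooth chart of `M` composed with `π`. -/
class FibredManifold {M E : Type*} [TopologicalSpace M] [ChartedSpace (BaseModel m) M]
    [TopologicalSpace E] [ChartedSpace (TotModel m n) E] (π : E → M) : Prop where
  surjective : Function.Surjective π
  adapted : ∀ e ∈ atlas (TotModel m n) E,
    ∃ φ ∈ IsManifold.maximalAtlas 𝓘(ℝ, BaseModel m) ∞ M,
      ∀ u ∈ e.source, π u ∈ φ.source ∧ (e u).1 = φ (π u)

variable {M E : Type*} [TopologicalSpace M] [ChartedSpace (BaseModel m) M]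
  [TopologicalSpace E] [ChartedSpace (TotModel m n) E]
  [IsManifold 𝓘(ℝ, TotModel m n) ∞ E]

/-- The derivatives of the changes of adapted coordinates preserve the vertical vectors. -/
theorem preservesVertical_coordChange (π : E → M) [FibredManifold m n π]
    (i j : atlas (TotModel m n) E) {x : E} (hi : x ∈ i.1.source) (hj : x ∈ j.1.source) :
    PreservesVertical ((tangentBundleCore 𝓘(ℝ, TotModel m n) E).coordChange i j x) := by
  intro v
  obtain ⟨φ, -, hφ⟩ := FibredManifold.adapted (π := π) i.1 i.2
  obtain ⟨φ', -, hφ'⟩ := FibredManifold.adapted (π := π) j.1 j.2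
  set g : TotModel m n → TotModel m n := fun y => j.1 (i.1.symm y) with hg
  have hcd : (tangentBundleCore 𝓘(ℝ, TotModel m n) E).coordChange i j x
      = fderiv ℝ g (i.1 x) := by
    rw [tangentBundleCore_coordChange]
    simp only [modelWithCornersSelf_coe, range_id, fderivWithin_univ]
    rfl
  have hdiff : DifferentiableAt ℝ g (i.1 x) := by
    have h := ModelWithCorners.contDiffWithinAt_extendCoordChange' (n := ∞)
      (I := 𝓘(ℝ, TotModel m n))
      (IsManifold.subset_maximalAtlas i.2) (IsManifold.subset_maximalAtlas j.2) hi hj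
    have h2 := h.differentiableWithinAt (by simp)
    simp only [modelWithCornersSelf_coe, range_id, differentiableWithinAt_univ] at h2
    exact h2
  have hline : HasDerivAt (fun t : ℝ => i.1 x + t • ((0 : BaseModel m), v)) ((0 : BaseModel m), v)
      0 := by
    simpa using ((hasDerivAt_id (0 : ℝ)).smul_const ((0 : BaseModel m), v)).const_add (i.1 x)
  have hdiff' : HasFDerivAt g (fderiv ℝ g (i.1 x))
      (i.1 x + (0 : ℝ) • ((0 : BaseModel m), v)) := by
    simpa using hdiff.hasFDerivAt
  have hcomp := (ContinuousLinearMap.fst ℝ (BaseModel m) (FibreModel n)).hasFDerivAt.comp_hasDerivAt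
    (0 : ℝ) (hdiff'.comp_hasDerivAt (0 : ℝ) hline)
  have hconst : (fun t : ℝ => (g (i.1 x + t • ((0 : BaseModel m), v))).1) =ᶠ[𝓝 0]
      fun _ => φ' (φ.symm (i.1 x).1) := by
    have hopen : IsOpen (i.1.target ∩ i.1.symm ⁻¹' j.1.source) :=
      i.1.isOpen_inter_preimage_symm j.1.open_source
    have hmem : i.1 x + (0 : ℝ) • ((0 : BaseModel m), v) ∈
        i.1.target ∩ i.1.symm ⁻¹' j.1.source := by
      simp only [zero_smul, add_zero]
      exact ⟨i.1.map_source hi, by simpa [i.1.left_inv hi] using hj⟩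
    filter_upwards [hline.continuousAt.preimage_mem_nhds (hopen.mem_nhds hmem)] with t ht
    obtain ⟨ht1, ht2⟩ := ht
    have e1 := hφ _ (i.1.map_target ht1)
    have e2 := hφ' _ ht2
    rw [i.1.right_inv ht1] at e1
    have e3 : π (i.1.symm (i.1 x + t • ((0 : BaseModel m), v))) = φ.symm (i.1 x).1 := by
      rw [← φ.left_inv e1.1, ← e1.2]
      simp
    change (j.1 (i.1.symm (i.1 x + t • ((0 : BaseModel m), v)))).1 = _
    rw [e2.2, e3]
  have hzero := (hasDerivAt_const (0 : ℝ) (φ' (φ.symm (i.1 x).1))).congr_of_eventuallyEq hconst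
  rw [hcd]
  exact hcomp.unique hzero

/-- The vector bundle over `E` associated with a contravariant action `ρ` of the vertical-preserving
linear maps, in the charts of `E`. The index of the preferred trivialization at `u : E` is the chart
that Mathlib uses to identify `T_u E` with the model, so that the fibre at `u` is the same
functor of vector spaces applied to `T_u E`. -/
def assocCore {F : Type*} [NormedAddCommGroup F] [NormedSpace ℝ F] (π : E → M)
    [FibredManifold m n π] (ρ : (TotModel m n →L[ℝ] TotModel m n) → F →L[ℝ] F)
    (hρ : ContDiff ℝ ∞ ρ) (hid : ρ (ContinuousLinearMap.id ℝ _) = ContinuousLinearMap.id ℝ _)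
    (hcomp : ∀ A B, PreservesVertical A → PreservesVertical B →
      (ρ A).comp (ρ B) = ρ (B.comp A)) :
    VectorBundleCore ℝ E F (atlas (TotModel m n) E) where
  baseSet i := i.1.source
  isOpen_baseSet i := i.1.open_source
  indexAt := achart (TotModel m n)
  mem_baseSet_at := mem_chart_source (TotModel m n)
  coordChange i j x := ρ ((tangentBundleCore 𝓘(ℝ, TotModel m n) E).coordChange j i x)
  coordChange_self i x hx v := by
    have h : (tangentBundleCore 𝓘(ℝ, TotModel m n) E).coordChange i i x =
        ContinuousLinearMap.id ℝ _ :=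
      ContinuousLinearMap.ext fun w =>
        (tangentBundleCore 𝓘(ℝ, TotModel m n) E).coordChange_self i x hx w
    rw [h, hid]
    rfl
  continuousOn_coordChange i j := by
    refine hρ.continuous.comp_continuousOn ?_
    exact ((tangentBundleCore 𝓘(ℝ, TotModel m n) E).continuousOn_coordChange j i).mono
      (by rw [inter_comm]; exact subset_rfl)
  coordChange_comp i j k x hx v := by
    obtain ⟨⟨hi, hj⟩, hk⟩ := hx
    rw [← ContinuousLinearMap.comp_apply, hcomp _ _
      (preservesVertical_coordChange m n π k j hk hj)
      (preservesVertical_coordChange m n π j i hj hi),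
      (tangentBundleCore 𝓘(ℝ, TotModel m n) E).coordChange_linear_comp k j i x ⟨⟨hk, hj⟩, hi⟩]

/-- `Λᵐ₂(T*E)` as a vector bundle over `E`. -/
def extCore (π : E → M) [FibredManifold m n π] :
    VectorBundleCore ℝ E (ExtFibre m n) (atlas (TotModel m n) E) :=
  assocCore m n π pullExt contDiff_pullExt pullExt_id fun _ _ => pullExt_comp

/-- `Λᵐ₂(T*E) / Λᵐ₁(T*E)` as a vector bundle over `E`. -/
def resCore (π : E → M) [FibredManifold m n π] :
    VectorBundleCore ℝ E (ResFibre m n) (atlas (TotModel m n) E) :=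
  assocCore m n π pullRes contDiff_pullRes pullRes_id fun _ _ => pullRes_comp

theorem contMDiffOn_tangent_coordChange (i j : atlas (TotModel m n) E) :
    ContMDiffOn 𝓘(ℝ, TotModel m n) 𝓘(ℝ, TotModel m n →L[ℝ] TotModel m n) ∞
      ((tangentBundleCore 𝓘(ℝ, TotModel m n) E).coordChange j i) (i.1.source ∩ j.1.source) := by
  have : IsManifold 𝓘(ℝ, TotModel m n) (∞ + 1) E := by simpa
  have : (tangentBundleCore 𝓘(ℝ, TotModel m n) E).IsContMDiff 𝓘(ℝ, TotModel m n) ∞ :=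
    tangentBundleCore.isContMDiff
  rw [inter_comm]
  exact (tangentBundleCore 𝓘(ℝ, TotModel m n) E).contMDiffOn_coordChange
    𝓘(ℝ, TotModel m n) j i

instance isContMDiff_extCore (π : E → M) [FibredManifold m n π] :
    (extCore m n π).IsContMDiff 𝓘(ℝ, TotModel m n) ∞ :=
  ⟨fun i j => contDiff_pullExt.contMDiff.comp_contMDiffOn
    (contMDiffOn_tangent_coordChange m n i j)⟩

instance isContMDiff_resCore (π : E → M) [FibredManifold m n π] :
    (resCore m n π).IsContMDiff 𝓘(ℝ, TotModel m n) ∞ :=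
  ⟨fun i j => contDiff_pullRes.contMDiff.comp_contMDiffOn
    (contMDiffOn_tangent_coordChange m n i j)⟩

/-- The extended dual jet bundle `Λᵐ₂(T*E)`, a smooth manifold. The projection `π_E` to `E` is
`Bundle.TotalSpace.proj`. -/
abbrev ExtDual (π : E → M) [FibredManifold m n π] : Type _ :=
  Bundle.TotalSpace (ExtFibre m n) (extCore m n π).Fiber

/-- The restricted dual jet bundle `J¹π* = Λᵐ₂(T*E) / Λᵐ₁(T*E)`, a smooth manifold. The projection
`π_E^r` to `E` is `Bundle.TotalSpace.proj`. -/
abbrev ResDual (π : E → M) [FibredManifold m n π] : Type _ :=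
  Bundle.TotalSpace (ResFibre m n) (resCore m n π).Fiber

/-- Model with corners (without boundary) of `ExtDual`. -/
abbrev extModel : ModelWithCorners ℝ (TotModel m n × ExtFibre m n)
    (ModelProd (TotModel m n) (ExtFibre m n)) :=
  𝓘(ℝ, TotModel m n).prod 𝓘(ℝ, ExtFibre m n)

/-- Model with corners (without boundary) of `ResDual`. -/
abbrev resModel : ModelWithCorners ℝ (TotModel m n × ResFibre m n)
    (ModelProd (TotModel m n) (ResFibre m n)) :=
  𝓘(ℝ, TotModel m n).prod 𝓘(ℝ, ResFibre m n)

/-- The quotient map `μ : Λᵐ₂(T*E) → J¹π*`. -/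
def quotientMap (π : E → M) [FibredManifold m n π] (q : ExtDual m n π) : ResDual m n π :=
  ⟨q.proj, resMk m n (show ExtFibre m n from q.2)⟩

/-- A point of `Λᵐ₂(T*E)` over `u` as an alternating form on `T_u E`. -/
def toForm (π : E → M) [FibredManifold m n π] (q : ExtDual m n π) :
    TangentSpace 𝓘(ℝ, TotModel m n) q.proj [⋀^Fin m]→L[ℝ] ℝ :=
  inclForm m n (show ExtFibre m n from q.2)

end Bundles

/-! ### Differential forms, distributions and integral sections on manifolds -/

section Manifolds

variable {V : Type*} [NormedAddCommGroup V] [NormedSpace ℝ V] {H : Type*} [TopologicalSpace H]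
  (I : ModelWithCorners ℝ V H) {P : Type*} [TopologicalSpace P] [ChartedSpace H P]
  {V' : Type*} [NormedAddCommGroup V'] [NormedSpace ℝ V'] {H' : Type*} [TopologicalSpace H']
  (I' : ModelWithCorners ℝ V' H') {P' : Type*} [TopologicalSpace P'] [ChartedSpace H' P']

variable (P) in
/-- Differential `k`-forms (no regularity is imposed here). -/
abbrev DiffForm (k : ℕ) : Type _ := ∀ p : P, TangentSpace I p [⋀^Fin k]→L[ℝ] ℝ

/-- Pull-back `f*τ`. -/
def pullback {k : ℕ} (f : P → P') (τ : DiffForm I' P' k) : DiffForm I P k :=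
  fun p => (τ (f p)).compContinuousLinearMap (mfderiv I I' f p)

/-- Exterior derivative of a form on a manifold, computed at each point in the preferred chart
there. -/
def extDiff {k : ℕ} (τ : DiffForm I P k) : DiffForm I P (k + 1) := fun p =>
  (extDerivWithin
    (fun y : V => ((τ ((extChartAt I p).symm y)).compContinuousLinearMap
      (mfderivWithin 𝓘(ℝ, V) I (extChartAt I p).symm (range I) y) : V [⋀^Fin k]→L[ℝ] ℝ))
    (range I) (extChartAt I p p)).compContinuousLinearMap
      (mfderiv I 𝓘(ℝ, V) (extChartAt I p) p)

/-- `T_p f`-image of the whole tangent space: the tangent space to `Im f` at `f p` for an immersion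
`f`. -/
def tangentImage (f : P → P') (p : P) : Submodule ℝ (TangentSpace I' (f p)) :=
  LinearMap.range (mfderiv I I' f p : TangentSpace I p →ₗ[ℝ] TangentSpace I' (f p))

/-- The `l`-th orthogonal complement of a subspace with respect to an alternating
`(l+1)`-form. -/
def orthogonalComplement {l : ℕ} {p : P} (τ : TangentSpace I p [⋀^Fin (l + 1)]→L[ℝ] ℝ)
    (F : Submodule ℝ (TangentSpace I p)) : Set (TangentSpace I p) :=
  {w | ∀ v : Fin l → TangentSpace I p, (∀ i, v i ∈ F) →
    τ (Fin.cons (α := fun _ => TangentSpace I p) w v) = 0}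

/-- The submanifold parametrized by `f` is `l`-Lagrangian for the `(l+1)`-form `τ`. -/
def IsLagrangianImage {l : ℕ} (τ : DiffForm I' P' (l + 1)) (f : P → P') : Prop :=
  ∀ p : P, (tangentImage I I' f p : Set (TangentSpace I' (f p))) =
    orthogonalComplement I' (τ (f p)) (tangentImage I I' f p)

variable (P) in
/-- A (not necessarily regular) field of subspaces of the tangent spaces. -/
abbrev Distribution : Type _ := ∀ p : P, Submodule ℝ (TangentSpace I p)

variable {I} in
/-- `D` is a smooth distribution of rank `k`: locally it is spanned by `k` pointwise linearly
independent smooth vector fields. -/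
def IsSmoothOfRank [IsManifold I 1 P] (k : ℕ) (D : Distribution I P) : Prop :=
  ∀ p : P, ∃ U : Set P, IsOpen U ∧ p ∈ U ∧
    ∃ X : Fin k → ∀ q : P, TangentSpace I q,
      (∀ i, ContMDiffOn I I.tangent ∞ (fun q => (⟨q, X i q⟩ : TangentBundle I P)) U) ∧
      ∀ q ∈ U, LinearIndependent ℝ (fun i => X i q) ∧
        D q = Submodule.span ℝ (Set.range fun i => X i q)

variable {I} in
/-- `D` is transverse to the fibres of `f`. -/
def IsTransverse (f : P → P') (D : Distribution I P) : Prop :=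
  ∀ p : P, IsCompl (D p)
    (LinearMap.ker (mfderiv I I' f p : TangentSpace I p →ₗ[ℝ] TangentSpace I' (f p)))

variable {I} in
/-- `σ` is an integral section over `N` of the distribution `D` on the total space of `f : P → P'`:
on an open neighbourhood of `N` it is a smooth section of `f` whose image has tangent space `D`.
(If `N` is open, that neighbourhood may be taken to be `N` itself; the values of `σ` outside of the
neighbourhood play no role.) -/
def IsIntegralSection (f : P → P') (D : Distribution I P) (N : Set P') (σ : P' → P) : Prop :=
  ∃ U : Set P', IsOpen U ∧ N ⊆ U ∧ ContMDiffOn I' I ∞ σ U ∧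
    ∀ x ∈ U, f (σ x) = x ∧ tangentImage I' I σ x = D (σ x)

variable {I} in
/-- Integrability of a distribution that is transverse to `f`: through every point there passes
an integral section. -/
def IsIntegrable (f : P → P') (D : Distribution I P) : Prop :=
  ∀ p : P, ∃ σ : P' → P, IsIntegralSection I' f D {f p} σ ∧ σ (f p) = p

/-- `N` is a connected domain with smooth nonempty boundary: near each of its points `N` is either
everything or a half space `{g ≤ 0}` with `g` smooth, and the points of the second kind, which
form the boundary `N \ interior N`, do occur. -/
structure IsDomainWithBoundary (N : Set P) : Prop where
  connected : IsConnected N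
  boundary_nonempty : (N \ interior N).Nonempty
  smooth_boundary : ∀ x ∈ N \ interior N, ∃ (U : Set P) (g : P → ℝ), IsOpen U ∧ x ∈ U ∧
    ContMDiffOn I 𝓘(ℝ, ℝ) ∞ g U ∧ g x = 0 ∧ mfderiv I 𝓘(ℝ, ℝ) g x ≠ 0 ∧
    N ∩ U = {y ∈ U | g y ≤ 0}

end Manifolds

/-! ### Hamiltonian field theory and the Hamilton–Jacobi problem -/

section Hamiltonian

variable (m n)
variable {M E : Type*} [TopologicalSpace M] [ChartedSpace (BaseModel m) M]
  [TopologicalSpace E] [ChartedSpace (TotModel m n) E]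
  [IsManifold 𝓘(ℝ, TotModel m n) ∞ E] (π : E → M) [FibredManifold m n π]

/-- The Liouville (tautological) `m`-form on `Λᵐ₂(T*E)`. -/
def liouvilleForm : DiffForm (extModel m n) (ExtDual m n π) m := fun q =>
  (toForm m n π q).compContinuousLinearMap
    (mfderiv (extModel m n) 𝓘(ℝ, TotModel m n) Bundle.TotalSpace.proj q)

/-- `h` is a Hamiltonian section, that is, a smooth section of `μ : Λᵐ₂(T*E) → J¹π*`. -/
def IsHamiltonianSection (h : ResDual m n π → ExtDual m n π) : Prop :=
  ContMDiff (resModel m n) (extModel m n) ∞ h ∧ ∀ p, quotientMap m n π (h p) = p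

/-- The Hamilton–Cartan form `Ω_h = -d(h*Θ)`. -/
def hamiltonCartan (h : ResDual m n π → ExtDual m n π) :
    DiffForm (resModel m n) (ResDual m n π) (m + 1) := fun p =>
  -extDiff (resModel m n) (pullback (resModel m n) (extModel m n) h (liouvilleForm m n π)) p

/-- The projection of `J¹π*` to `M`. -/
def projBase (p : ResDual m n π) : M := π p.proj

/-- The field equation: `ψ* (i(X) Ω) = 0` on `U` for every smooth vector field `X`. -/
def SolvesFieldEquation (Ω : DiffForm (resModel m n) (ResDual m n π) (m + 1)) (U : Set M)
    (ψ : M → ResDual m n π) : Prop :=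
  ∀ X : ∀ p : ResDual m n π, TangentSpace (resModel m n) p,
    ContMDiff (resModel m n) (resModel m n).tangent ∞
      (fun p => (⟨p, X p⟩ : TangentBundle (resModel m n) (ResDual m n π))) →
    ∀ x ∈ U, ∀ v : Fin m → TangentSpace 𝓘(ℝ, BaseModel m) x,
      Ω (ψ x) (Fin.cons (α := fun _ => TangentSpace (resModel m n) (ψ x)) (X (ψ x))
        fun i => mfderiv 𝓘(ℝ, BaseModel m) (resModel m n) ψ x (v i)) = 0

/-- `D` is a solution of the Hamiltonian problem: a smooth distribution in `J¹π*` of rank `m`,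
transverse to the projection to `M`, integrable, all of whose integral sections solve the
field equation. -/
structure IsHamiltonianDistribution (h : ResDual m n π → ExtDual m n π)
    (D : Distribution (resModel m n) (ResDual m n π)) : Prop where
  smooth : IsSmoothOfRank m D
  transverse : IsTransverse 𝓘(ℝ, BaseModel m) (projBase m n π) D
  integrable : IsIntegrable 𝓘(ℝ, BaseModel m) (projBase m n π) D
  field_equation : ∀ (U : Set M) (ψ : M → ResDual m n π), IsOpen U →
    IsIntegralSection 𝓘(ℝ, BaseModel m) (projBase m n π) D U ψ →
    SolvesFieldEquation m n π (hamiltonCartan m n π h) U ψ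

/-- Smooth sections of `J¹π* → E`. -/
abbrev DualSection : Type _ :=
  ContMDiffSection 𝓘(ℝ, TotModel m n) (ResFibre m n) ∞ (resCore m n π).Fiber

variable {m n π}

/-- A section of `J¹π* → E` as a map into the manifold `J¹π*`. -/
abbrev DualSection.toMap (s : DualSection m n π) (u : E) : ResDual m n π := ⟨u, s u⟩

/-- The distribution `Tπ_E^r (D|_{Im s})` on `E` associated with `s`. -/
def projectedDistribution (s : DualSection m n π)
    (D : Distribution (resModel m n) (ResDual m n π)) : Distribution 𝓘(ℝ, TotModel m n) E :=
  fun u => (D (s.toMap u)).map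
    (mfderiv (resModel m n) 𝓘(ℝ, TotModel m n) Bundle.TotalSpace.proj (s.toMap u) :
      TangentSpace (resModel m n) (s.toMap u) →ₗ[ℝ] TangentSpace 𝓘(ℝ, TotModel m n) u)

/-- `s` solves the generalized Hamiltonian Hamilton–Jacobi problem: the associated distribution is
integrable and `s` maps its (local) integral sections to integral sections of `D`. -/
def SolvesGeneralizedHJ (D : Distribution (resModel m n) (ResDual m n π))
    (s : DualSection m n π) : Prop :=
  IsIntegrable 𝓘(ℝ, BaseModel m) π (projectedDistribution s D) ∧
  ∀ (U : Set M) (γ : M → E), IsOpen U →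
    IsIntegralSection 𝓘(ℝ, BaseModel m) π (projectedDistribution s D) U γ →
    IsIntegralSection 𝓘(ℝ, BaseModel m) (projBase m n π) D U fun x => s.toMap (γ x)

/-- `s` solves the Hamiltonian Hamilton–Jacobi problem. -/
def SolvesHJ (h : ResDual m n π → ExtDual m n π)
    (D : Distribution (resModel m n) (ResDual m n π)) (s : DualSection m n π) : Prop :=
  SolvesGeneralizedHJ D s ∧
    pullback 𝓘(ℝ, TotModel m n) (resModel m n) s.toMap (hamiltonCartan m n π h) = 0

/-- The distribution `D` is tangent to the submanifold `Im s`. -/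
def IsTangentTo (D : Distribution (resModel m n) (ResDual m n π)) (s : DualSection m n π) : Prop :=
  ∀ u : E, D (s.toMap u) ≤ tangentImage 𝓘(ℝ, TotModel m n) (resModel m n) s.toMap u

/-- `ψ` satisfies boundary conditions in `Im s` on the domain with boundary `N`. -/
def HasBoundaryValuesIn (s : DualSection m n π) (N : Set M) (ψ : M → ResDual m n π) : Prop :=
  ∀ x ∈ N \ interior N, ψ x ∈ Set.range s.toMap

/-- The integral sections of `D` with boundary conditions in `Im s` project onto the integral
sections of the integrable distribution associated with `s`: over each domain with boundary, the
projections of the former are integral sections of the latter, and all of them arise so. -/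
def BoundarySectionsProjectOnto (D : Distribution (resModel m n) (ResDual m n π))
    (s : DualSection m n π) : Prop :=
  IsIntegrable 𝓘(ℝ, BaseModel m) π (projectedDistribution s D) ∧
  ∀ N : Set M, IsDomainWithBoundary 𝓘(ℝ, BaseModel m) N →
    (∀ ψ : M → ResDual m n π,
      IsIntegralSection 𝓘(ℝ, BaseModel m) (projBase m n π) D N ψ → HasBoundaryValuesIn s N ψ →
      IsIntegralSection 𝓘(ℝ, BaseModel m) π (projectedDistribution s D) N
        fun x => (ψ x).proj) ∧
    (∀ γ : M → E,
      IsIntegralSection 𝓘(ℝ, BaseModel m) π (projectedDistribution s D) N γ →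
      ∃ ψ : M → ResDual m n π,
        IsIntegralSection 𝓘(ℝ, BaseModel m) (projBase m n π) D N ψ ∧
        HasBoundaryValuesIn s N ψ ∧ ∀ x ∈ N, (ψ x).proj = γ x)

end Hamiltonian

end

end HJ

namespace HJ

section GronwallArgument

variable {F G : Type*} [NormedAddCommGroup F] [NormedSpace ℝ F] [NormedAddCommGroup G]
  [NormedSpace ℝ G]

/-- A function whose derivative is bounded by a multiple of the function vanishes near each of its
zeros. -/
theorem eventually_eq_zero_of_norm_fderiv_le {δ : F → G} {δ' : F → F →L[ℝ] G} {K : ℝ} {x₀ : F}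
    (hδ : ∀ᶠ x in 𝓝 x₀, HasFDerivAt δ (δ' x) x ∧ ‖δ' x‖ ≤ K * ‖δ x‖) (h0 : δ x₀ = 0) :
    ∀ᶠ x in 𝓝 x₀, δ x = 0 := by
  obtain ⟨r, hr, hball⟩ := Metric.eventually_nhds_iff_ball.1 hδ
  filter_upwards [Metric.ball_mem_nhds x₀ hr] with x hx
  have hseg : ∀ t ∈ Icc (0 : ℝ) 1, x₀ + t • (x - x₀) ∈ Metric.ball x₀ r := by
    intro t ht
    have := (convex_ball x₀ r).add_smul_sub_mem (Metric.mem_ball_self hr) hx ht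
    simpa using this
  have hd : ∀ t ∈ Icc (0 : ℝ) 1, HasDerivAt (fun t : ℝ => δ (x₀ + t • (x - x₀)))
      (δ' (x₀ + t • (x - x₀)) (x - x₀)) t := by
    intro t ht
    have hline : HasDerivAt (fun t : ℝ => x₀ + t • (x - x₀)) (x - x₀) t := by
      simpa using ((hasDerivAt_id t).smul_const (x - x₀)).const_add x₀
    exact (hball _ (hseg t ht)).1.comp_hasDerivAt t hline
  have := eq_zero_of_abs_deriv_le_mul_abs_self_of_eq_zero_right
    (f := fun t : ℝ => δ (x₀ + t • (x - x₀))) (K := K * ‖x - x₀‖) (a := 0) (b := 1)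
    (fun t ht => (hd t ht).continuousAt.continuousWithinAt)
    (fun t ht => (hd t (Ico_subset_Icc_self ht)).hasDerivWithinAt) (by simpa using h0)
    (fun t ht => by
      refine (ContinuousLinearMap.le_opNorm _ _).trans ?_
      have := mul_le_mul_of_nonneg_right (hball _ (hseg t (Ico_subset_Icc_self ht))).2
        (norm_nonneg (x - x₀))
      linarith) 1 (by simp)
  simpa using this

end GronwallArgument

section Lift

variable {V : Type*} [NormedAddCommGroup V] [NormedSpace ℝ V] {H : Type*} [TopologicalSpace H]
  {I : ModelWithCorners ℝ V H} {P : Type*} [TopologicalSpace P] [ChartedSpace H P]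
  {V' : Type*} [NormedAddCommGroup V'] [NormedSpace ℝ V'] {H' : Type*} [TopologicalSpace H']
  {I' : ModelWithCorners ℝ V' H'} {P' : Type*} [TopologicalSpace P'] [ChartedSpace H' P']

/-- The coordinate expression of a smooth vector field along a map is smooth. -/
theorem contMDiffAt_mfderiv_extChartAt_apply [IsManifold I' 1 P'] {g : P → TangentBundle I' P'}
    {p : P} {k : ℕ∞ω} (hg : ContMDiffAt I I'.tangent k g p) :
    ContMDiffAt I 𝓘(ℝ, V') k (fun q =>
      (mfderiv I' 𝓘(ℝ, V') (extChartAt I' (g p).proj) (g q).proj (g q).2 : V')) p := by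
  obtain ⟨h1, h2⟩ := (Bundle.contMDiffAt_totalSpace).1 hg
  refine h2.congr_of_eventuallyEq ?_
  filter_upwards [h1.continuousAt.preimage_mem_nhds
    ((chartAt H' (g p).proj).open_source.mem_nhds (mem_chart_source H' _))] with q hq
  have h3 := TangentBundle.continuousLinearMapAt_trivializationAt (I := I') (M := P')
    (x₀ := (g p).proj) (x := (g q).proj) hq
  have h4 := Bundle.Trivialization.coe_linearMapAt_of_mem (R := ℝ)
    (trivializationAt V' (TangentSpace I' : P' → Type _) (g p).proj) (b := (g q).proj) (by simpa using hq)
  exact (DFunLike.congr_fun h3 (g q).2).symm.trans (congrFun h4 (g q).2)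

/-- A smooth family of linear maps sending one smooth frame to a family of smooth vectors. -/
theorem exists_contMDiffAt_map_frame [FiniteDimensional ℝ V'] {k : ℕ}
    (hk : k = Module.finrank ℝ V') {x : Fin k → P → V} {y : Fin k → P → V'} {p : P} {r : ℕ∞ω}
    (hx : ∀ i, ContMDiffAt I 𝓘(ℝ, V) r (x i) p) (hy : ∀ i, ContMDiffAt I 𝓘(ℝ, V') r (y i) p)
    (hli : ∀ᶠ q in 𝓝 p, LinearIndependent ℝ fun i => y i q) :
    ∃ L : P → V' →L[ℝ] V, ContMDiffAt I 𝓘(ℝ, V' →L[ℝ] V) r L p ∧ ∀ᶠ q in 𝓝 p,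
      (∀ a : Fin k → ℝ, L q (∑ i, a i • y i q) = ∑ i, a i • x i q) ∧
      ∀ v, ∃ a : Fin k → ℝ, L q v = ∑ i, a i • x i q := by
  let A : P → (Fin k → ℝ) →L[ℝ] V := fun q =>
    ∑ i, ContinuousLinearMap.smulRightL ℝ _ V (ContinuousLinearMap.proj i) (x i q)
  let B : P → (Fin k → ℝ) →L[ℝ] V' := fun q =>
    ∑ i, ContinuousLinearMap.smulRightL ℝ _ V' (ContinuousLinearMap.proj i) (y i q)
  have hA : ContMDiffAt I 𝓘(ℝ, (Fin k → ℝ) →L[ℝ] V) r A p := by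
    refine contMDiffAt_finsetSum fun i _ => ?_
    exact (ContinuousLinearMap.contMDiff _).contMDiffAt.comp p (hx i)
  have hB : ContMDiffAt I 𝓘(ℝ, (Fin k → ℝ) →L[ℝ] V') r B p := by
    refine contMDiffAt_finsetSum fun i _ => ?_
    exact (ContinuousLinearMap.contMDiff _).contMDiffAt.comp p (hy i)
  have hAa : ∀ q a, A q a = ∑ i, a i • x i q := fun q a => by simp [A]
  have hBa : ∀ q a, B q a = ∑ i, a i • y i q := fun q a => by simp [B]
  have hBe : ∀ᶠ q in 𝓝 p, ∃ e : (Fin k → ℝ) ≃L[ℝ] V', (e : (Fin k → ℝ) →L[ℝ] V') = B q := by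
    filter_upwards [hli] with q hq
    have hinj : Function.Injective (B q : (Fin k → ℝ) →ₗ[ℝ] V') := by
      rw [← LinearMap.ker_eq_bot, LinearMap.ker_eq_bot']
      intro a ha
      have ha' : ∑ i, a i • y i q = 0 := by rw [← hBa]; exact ha
      funext i
      exact Fintype.linearIndependent_iff.1 hq a ha' i
    refine ⟨(LinearEquiv.ofInjectiveOfFinrankEq _ hinj (by simp [hk])).toContinuousLinearEquiv, ?_⟩
    ext a
    rfl
  obtain ⟨e, he⟩ := hBe.self_of_nhds
  refine ⟨fun q => (A q).comp (B q).inverse, ?_, ?_⟩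
  · refine hA.clm_comp ?_
    have := contDiffAt_map_inverse (𝕜 := ℝ) (n := r) e
    rw [he] at this
    exact this.contMDiffAt.comp p hB
  · filter_upwards [hBe] with q ⟨e, he⟩
    rw [← he, ContinuousLinearMap.inverse_equiv]
    refine ⟨fun a => ?_, fun v => ⟨e.symm v, by simp [hAa]⟩⟩
    rw [← hBa, ← he, ← hAa]
    simp

/-- The horizontal lift of a smooth transverse distribution, in charts. -/
theorem exists_horizontalLift [IsManifold I ∞ P] [IsManifold I' ∞ P']
    [FiniteDimensional ℝ V'] {k : ℕ} (hk : k = Module.finrank ℝ V')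
    {f : P → P'} (hf : ContMDiff I I' ∞ f) {D : Distribution I P}
    (hD : IsSmoothOfRank k D) (hT : IsTransverse I' f D)
    {p : P} {x₀ : P'} (hp : f p = x₀) :
    ∃ L : P → V' →L[ℝ] V, ContMDiffAt I 𝓘(ℝ, V' →L[ℝ] V) ∞ L p ∧ ∀ᶠ q in 𝓝 p,
      (∀ ξ ∈ D q, mfderiv I 𝓘(ℝ, V) (extChartAt I p) q ξ =
        L q (mfderiv I' 𝓘(ℝ, V') (extChartAt I' x₀) (f q) (mfderiv I I' f q ξ))) ∧
      ∀ v, ∃ ξ ∈ D q, mfderiv I 𝓘(ℝ, V) (extChartAt I p) q ξ = L q v := by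
  subst hp
  obtain ⟨U, hU, hpU, X, hX, hXD⟩ := hD p
  have hXp : ∀ i, ContMDiffAt I I.tangent ∞ (fun q => (⟨q, X i q⟩ : TangentBundle I P)) p :=
    fun i => (hX i).contMDiffAt (hU.mem_nhds hpU)
  have hfX : ∀ i, ContMDiffAt I I'.tangent ∞
      (fun q => (⟨f q, mfderiv I I' f q (X i q)⟩ : TangentBundle I' P')) p := fun i =>
    ((hf.contMDiff_tangentMap (m := ∞) (by simp)).contMDiffAt).comp p (hXp i)
  let x : Fin k → P → V := fun i q => mfderiv I 𝓘(ℝ, V) (extChartAt I p) q (X i q)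
  let y : Fin k → P → V' := fun i q =>
    mfderiv I' 𝓘(ℝ, V') (extChartAt I' (f p)) (f q) (mfderiv I I' f q (X i q))
  have hx : ∀ i, ContMDiffAt I 𝓘(ℝ, V) ∞ (x i) p := fun i =>
    contMDiffAt_mfderiv_extChartAt_apply
      (g := fun q => (⟨q, X i q⟩ : TangentBundle I P)) (hXp i)
  have hy : ∀ i, ContMDiffAt I 𝓘(ℝ, V') ∞ (y i) p := fun i =>
    contMDiffAt_mfderiv_extChartAt_apply
      (g := fun q => (⟨f q, mfderiv I I' f q (X i q)⟩ : TangentBundle I' P')) (hfX i)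
  have hli : ∀ᶠ q in 𝓝 p, LinearIndependent ℝ fun i => y i q := by
    filter_upwards [hU.mem_nhds hpU, hf.continuous.continuousAt.preimage_mem_nhds
      (extChartAt_source_mem_nhds (I := I') (f p))] with q hq hq'
    have hinj : Function.Injective
        (mfderiv I' 𝓘(ℝ, V') (extChartAt I' (f p)) (f q)) :=
      (isInvertible_mfderiv_extChartAt hq').injective
    have hdis := (hT q).disjoint
    rw [(hXD q hq).2] at hdis
    have h1 := (hXD q hq).1.map (f := (mfderiv I I' f q :
      TangentSpace I q →ₗ[ℝ] TangentSpace I' (f q))) hdis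
    exact h1.map' (mfderiv I' 𝓘(ℝ, V') (extChartAt I' (f p)) (f q)).toLinearMap (LinearMap.ker_eq_bot.2 hinj)
  obtain ⟨L, hL, hLe⟩ := exists_contMDiffAt_map_frame hk hx hy hli
  refine ⟨L, hL, ?_⟩
  filter_upwards [hLe, hU.mem_nhds hpU] with q hq hqU
  rw [(hXD q hqU).2]
  refine ⟨fun ξ hξ => ?_, fun v => ?_⟩
  · obtain ⟨a, rfl⟩ := (Submodule.mem_span_range_iff_exists_fun ℝ).1 hξ
    have := hq.1 a
    simp only [map_sum, map_smul]
    exact this.symm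
  · obtain ⟨a, ha⟩ := hq.2 v
    refine ⟨∑ i, a i • X i q, (Submodule.mem_span_range_iff_exists_fun ℝ).2 ⟨a, rfl⟩, ?_⟩
    rw [ha]
    simp only [map_sum, map_smul]
    rfl

end Lift

section Uniqueness

variable {V : Type*} [NormedAddCommGroup V] [NormedSpace ℝ V] {H : Type*} [TopologicalSpace H]
  {I : ModelWithCorners ℝ V H} {P : Type*} [TopologicalSpace P] [ChartedSpace H P]
  {V' : Type*} [NormedAddCommGroup V'] [NormedSpace ℝ V'] {H' : Type*} [TopologicalSpace H']
  {I' : ModelWithCorners ℝ V' H'} {P' : Type*} [TopologicalSpace P'] [ChartedSpace H' P']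

theorem hasMFDerivAt_extChartAt_symm [IsManifold I 1 P] [I.Boundaryless] {p : P} {z : V}
    (hz : z ∈ (extChartAt I p).target) :
    HasMFDerivAt 𝓘(ℝ, V) I (extChartAt I p).symm z
      (mfderiv 𝓘(ℝ, V) I (extChartAt I p).symm z) := by
  have := mdifferentiableWithinAt_extChartAt_symm hz
  rw [I.range_eq_univ, mdifferentiableWithinAt_univ] at this
  exact this.hasMFDerivAt

theorem hasMFDerivAt_extChartAt [IsManifold I 1 P] {p q : P}
    (hq : q ∈ (extChartAt I p).source) :
    HasMFDerivAt I 𝓘(ℝ, V) (extChartAt I p) q (mfderiv I 𝓘(ℝ, V) (extChartAt I p) q) :=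
  (mdifferentiableAt_extChartAt (by simpa using hq)).hasMFDerivAt

/-- In charts, an integral section solves the total differential equation defined by the
horizontal lift. -/
theorem hasFDerivAt_integralSection [IsManifold I 1 P] [IsManifold I' 1 P'] [I'.Boundaryless]
    {f : P → P'} (hf : MDifferentiable I I' f) {D : Distribution I P} {U : Set P'} (hU : IsOpen U)
    {ψ : P' → P} (hψ : ContMDiffOn I' I ∞ ψ U)
    (hint : ∀ x ∈ U, f (ψ x) = x ∧ tangentImage I' I ψ x = D (ψ x))
    {p : P} {x₀ : P'} {L : V' →L[ℝ] V} {z : V'} (hz : z ∈ (extChartAt I' x₀).target)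
    (hzU : (extChartAt I' x₀).symm z ∈ U)
    (hp : ψ ((extChartAt I' x₀).symm z) ∈ (extChartAt I p).source)
    (hL : ∀ ξ ∈ D (ψ ((extChartAt I' x₀).symm z)),
      mfderiv I 𝓘(ℝ, V) (extChartAt I p) (ψ ((extChartAt I' x₀).symm z)) ξ =
        L (mfderiv I' 𝓘(ℝ, V') (extChartAt I' x₀) (f (ψ ((extChartAt I' x₀).symm z)))
          (mfderiv I I' f (ψ ((extChartAt I' x₀).symm z)) ξ))) :
    HasFDerivAt (fun z => extChartAt I p (ψ ((extChartAt I' x₀).symm z))) L z := by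
  have h1 := hasMFDerivAt_extChartAt_symm hz
  have h2 := ((hψ.contMDiffAt (hU.mem_nhds hzU)).mdifferentiableAt (by simp)).hasMFDerivAt
  have h3 := h2.comp z h1
  have h4 := (hasMFDerivAt_extChartAt hp).comp z h3
  have hfx : f (ψ ((extChartAt I' x₀).symm z)) ∈ (extChartAt I' x₀).source := by
    rw [(hint _ hzU).1]; exact (extChartAt I' x₀).map_target hz
  have h5 := (hasMFDerivAt_extChartAt hfx).comp z
    ((hf (ψ ((extChartAt I' x₀).symm z))).hasMFDerivAt.comp z h3)
  have hev : (extChartAt I' x₀ ∘ f ∘ ψ ∘ (extChartAt I' x₀).symm) =ᶠ[𝓝 z] id := by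
    filter_upwards [h1.continuousAt.preimage_mem_nhds (hU.mem_nhds hzU),
      (isOpen_extChartAt_target x₀).mem_nhds hz] with y hy hy'
    simp only [Function.comp_apply, (hint _ hy).1, id]
    exact (extChartAt I' x₀).right_inv hy'
  have h6 := hasMFDerivAt_unique h5
    ((hasMFDerivAt_id (I := 𝓘(ℝ, V')) z).congr_of_eventuallyEq hev)
  have h7 := hasMFDerivAt_iff_hasFDerivAt.1 h4
  refine h7.congr_fderiv ?_
  refine ContinuousLinearMap.ext fun v => ?_
  have h8 := hL (mfderiv I' I ψ _ (mfderiv 𝓘(ℝ, V') I' (extChartAt I' x₀).symm z v)) (by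
    rw [← (hint _ hzU).2]; exact ⟨_, rfl⟩)
  exact h8.trans (congrArg L (DFunLike.congr_fun h6 v))

theorem tendsto_integralSection_extChartAt_symm {U : Set P'} (hU : IsOpen U) {ψ : P' → P}
    {x₀ : P'} (hx₀ : x₀ ∈ U) (hψ : ContinuousOn ψ U) :
    Filter.Tendsto (fun z => ψ ((extChartAt I' x₀).symm z)) (𝓝 (extChartAt I' x₀ x₀))
      (𝓝 (ψ x₀)) := by
  have h1 : Filter.Tendsto (extChartAt I' x₀).symm (𝓝 (extChartAt I' x₀ x₀)) (𝓝 x₀) := by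
    simpa [ContinuousAt] using continuousAt_extChartAt_symm (I := I') x₀
  exact (hψ.continuousAt (hU.mem_nhds hx₀)).tendsto.comp h1

theorem eventually_of_eventually_extChartAt_symm {x₀ : P'} {Q : P' → Prop}
    (h : ∀ᶠ z in 𝓝 (extChartAt I' x₀ x₀), Q ((extChartAt I' x₀).symm z)) :
    ∀ᶠ x in 𝓝 x₀, Q x := by
  filter_upwards [(continuousAt_extChartAt (I := I') x₀).eventually h,
    extChartAt_source_mem_nhds (I := I') x₀] with x hx hx'
  rwa [(extChartAt I' x₀).left_inv hx'] at hx

/-- In charts around a common value, an integral section solves the total differential equation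
defined by the horizontal lift. -/
theorem eventually_hasFDerivAt_integralSection [IsManifold I 1 P] [IsManifold I' 1 P']
    [I'.Boundaryless]
    {f : P → P'} (hf : MDifferentiable I I' f) {D : Distribution I P} {U : Set P'} (hU : IsOpen U)
    {ψ : P' → P} (hψ : ContMDiffOn I' I ∞ ψ U)
    (hint : ∀ x ∈ U, f (ψ x) = x ∧ tangentImage I' I ψ x = D (ψ x))
    {p : P} {x₀ : P'} (hx₀ : x₀ ∈ U) (hp : ψ x₀ = p) {L : P → V' →L[ℝ] V}
    (hL : ∀ᶠ q in 𝓝 p, ∀ ξ ∈ D q, mfderiv I 𝓘(ℝ, V) (extChartAt I p) q ξ =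
      L q (mfderiv I' 𝓘(ℝ, V') (extChartAt I' x₀) (f q) (mfderiv I I' f q ξ))) :
    ∀ᶠ z in 𝓝 (extChartAt I' x₀ x₀), ψ ((extChartAt I' x₀).symm z) ∈ (extChartAt I p).source ∧
      HasFDerivAt (fun z => extChartAt I p (ψ ((extChartAt I' x₀).symm z)))
        (L (ψ ((extChartAt I' x₀).symm z))) z := by
  subst hp
  have ht := tendsto_integralSection_extChartAt_symm (I' := I') hU hx₀ hψ.continuousOn
  filter_upwards [ht.eventually hL, ht.eventually (extChartAt_source_mem_nhds (I := I) (ψ x₀)),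
    extChartAt_target_mem_nhds (I := I') x₀,
    (continuousAt_extChartAt_symm (I := I') x₀).preimage_mem_nhds
      (hU.mem_nhds (by simpa using hx₀))] with z hLz hz hzt hzU
  exact ⟨hz, hasFDerivAt_integralSection hf hU hψ hint hzt hzU hz hLz⟩

theorem contDiffAt_comp_extChartAt_symm [IsManifold I ∞ P] [I.Boundaryless] {W : Type*}
    [NormedAddCommGroup W] [NormedSpace ℝ W] {g : P → W} {p : P}
    (hg : ContMDiffAt I 𝓘(ℝ, W) ∞ g p) :
    ContDiffAt ℝ ∞ (fun y => g ((extChartAt I p).symm y)) (extChartAt I p p) := by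
  have h1 : ContMDiffAt 𝓘(ℝ, V) I ∞ (extChartAt I p).symm (extChartAt I p p) :=
    (contMDiffOn_extChartAt_symm p).contMDiffAt (extChartAt_target_mem_nhds p)
  refine contMDiffAt_iff_contDiffAt.1 (ContMDiffAt.comp _ ?_ h1)
  simpa using hg

/-- Two integral sections of a smooth transverse distribution which agree at a point agree near
that point. -/
theorem eventuallyEq_of_integralSection [IsManifold I ∞ P] [IsManifold I' ∞ P'] [I.Boundaryless]
    [I'.Boundaryless] [FiniteDimensional ℝ V'] {k : ℕ} (hk : k = Module.finrank ℝ V')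
    {f : P → P'} (hf : ContMDiff I I' ∞ f) {D : Distribution I P}
    (hD : IsSmoothOfRank k D) (hT : IsTransverse I' f D) {U₁ U₂ : Set P'} (hU₁ : IsOpen U₁)
    (hU₂ : IsOpen U₂) {ψ₁ ψ₂ : P' → P} (hψ₁ : ContMDiffOn I' I ∞ ψ₁ U₁)
    (hψ₂ : ContMDiffOn I' I ∞ ψ₂ U₂)
    (hint₁ : ∀ x ∈ U₁, f (ψ₁ x) = x ∧ tangentImage I' I ψ₁ x = D (ψ₁ x))
    (hint₂ : ∀ x ∈ U₂, f (ψ₂ x) = x ∧ tangentImage I' I ψ₂ x = D (ψ₂ x))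
    {x₀ : P'} (h₁ : x₀ ∈ U₁) (h₂ : x₀ ∈ U₂) (h : ψ₁ x₀ = ψ₂ x₀) :
    ∀ᶠ x in 𝓝 x₀, ψ₁ x = ψ₂ x := by
  obtain ⟨p, hp⟩ : ∃ p, ψ₁ x₀ = p := ⟨_, rfl⟩
  have hp₂ : ψ₂ x₀ = p := h ▸ hp
  obtain ⟨L, hL, hLe⟩ := exists_horizontalLift hk hf hD hT (hp ▸ (hint₁ x₀ h₁).1 : f p = x₀)
  have hf' : MDifferentiable I I' f := hf.mdifferentiable (by simp)
  obtain ⟨K, t, ht, hK⟩ :=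
    ((contDiffAt_comp_extChartAt_symm hL).of_le (by simp : (1 : ℕ∞ω) ≤ ∞)).exists_lipschitzOnWith
  have ht' : ∀ᶠ q in 𝓝 p, extChartAt I p q ∈ t := continuousAt_extChartAt (I := I) p ht
  have t₁ := tendsto_integralSection_extChartAt_symm (I' := I') hU₁ h₁ hψ₁.continuousOn
  have t₂ := tendsto_integralSection_extChartAt_symm (I' := I') hU₂ h₂ hψ₂.continuousOn
  rw [hp] at t₁
  rw [hp₂] at t₂
  have e₁ := eventually_hasFDerivAt_integralSection hf' hU₁ hψ₁ hint₁ h₁ hp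
    (hLe.mono fun q hq => hq.1)
  have e₂ := eventually_hasFDerivAt_integralSection hf' hU₂ hψ₂ hint₂ h₂ hp₂
    (hLe.mono fun q hq => hq.1)
  refine eventually_of_eventually_extChartAt_symm (I' := I') ?_
  have key := eventually_eq_zero_of_norm_fderiv_le (K := K)
    (δ := fun z => extChartAt I p (ψ₁ ((extChartAt I' x₀).symm z)) -
      extChartAt I p (ψ₂ ((extChartAt I' x₀).symm z)))
    (δ' := fun z => L (ψ₁ ((extChartAt I' x₀).symm z)) - L (ψ₂ ((extChartAt I' x₀).symm z)))
    (x₀ := extChartAt I' x₀ x₀) (by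
      filter_upwards [e₁, e₂, t₁.eventually ht', t₂.eventually ht'] with z hz₁ hz₂ hz₃ hz₄
      refine ⟨hz₁.2.sub hz₂.2, ?_⟩
      have := hK.dist_le_mul _ hz₃ _ hz₄
      rwa [dist_eq_norm, dist_eq_norm, (extChartAt I p).left_inv hz₁.1,
        (extChartAt I p).left_inv hz₂.1] at this) (by simp [h])
  filter_upwards [key, e₁, e₂] with z hz hz₁ hz₂
  exact (extChartAt I p).injOn hz₁.1 hz₂.1 (sub_eq_zero.1 hz)

/-- An integral section of a smooth transverse distribution which is tangent to the image of a
section `s` of `pr` stays in that image as soon as it meets it. -/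
theorem eventually_mem_image_of_integralSection [IsManifold I ∞ P] [IsManifold I' ∞ P']
    [I.Boundaryless] [I'.Boundaryless] [FiniteDimensional ℝ V'] {k : ℕ}
    (hk : k = Module.finrank ℝ V')
    {f : P → P'} (hf : ContMDiff I I' ∞ f) {D : Distribution I P}
    (hD : IsSmoothOfRank k D) (hT : IsTransverse I' f D)
    {W : Type*} [NormedAddCommGroup W] [NormedSpace ℝ W] {B : Type*} [TopologicalSpace B]
    {J : ModelWithCorners ℝ W B} {E : Type*} [TopologicalSpace E] [ChartedSpace B E]
    {pr : P → E} (hpr : ContMDiff I J ∞ pr) {s : E → P} (hs : ContMDiff J I ∞ s)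
    (hps : ∀ u, pr (s u) = u) (htan : ∀ u, D (s u) ≤ tangentImage J I s u)
    {U : Set P'} (hU : IsOpen U) {ψ : P' → P} (hψ : ContMDiffOn I' I ∞ ψ U)
    (hint : ∀ x ∈ U, f (ψ x) = x ∧ tangentImage I' I ψ x = D (ψ x))
    {x₀ : P'} (hx₀ : x₀ ∈ U) (h : s (pr (ψ x₀)) = ψ x₀) :
    ∀ᶠ x in 𝓝 x₀, s (pr (ψ x)) = ψ x := by
  obtain ⟨p, hp⟩ : ∃ p, ψ x₀ = p := ⟨_, rfl⟩
  have hSp : s (pr p) = p := hp ▸ h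
  obtain ⟨L, hL, hLe⟩ := exists_horizontalLift hk hf hD hT (hp ▸ (hint x₀ hx₀).1 : f p = x₀)
  have hf' : MDifferentiable I I' f := hf.mdifferentiable (by simp)
  have tψ := tendsto_integralSection_extChartAt_symm (I' := I') hU hx₀ hψ.continuousOn
  rw [hp] at tψ
  have e := eventually_hasFDerivAt_integralSection hf' hU hψ hint hx₀ hp
    (hLe.mono fun q hq => hq.1)
  let φ := extChartAt I p
  have hS : ContMDiff I I ∞ fun q => s (pr q) := hs.comp hpr
  have hScont : Filter.Tendsto (fun q => s (pr q)) (𝓝 p) (𝓝 p) := by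
    simpa [ContinuousAt, hSp] using hS.continuous.continuousAt (x := p)
  let Sc : V → V := fun y => φ (s (pr (φ.symm y)))
  have hSc : ContDiffAt ℝ ∞ Sc (φ p) := by
    refine contDiffAt_comp_extChartAt_symm (g := fun q => φ (s (pr q))) ?_
    refine ContMDiffAt.comp p ?_ hS.contMDiffAt
    rw [hSp]
    exact contMDiffAt_extChartAt
  let Lc : V → V' →L[ℝ] V := fun y => L (φ.symm y)
  have hLc : ContDiffAt ℝ ∞ Lc (φ p) := contDiffAt_comp_extChartAt_symm hL
  let G : V → V' →L[ℝ] V := fun y => Lc y - (fderiv ℝ Sc y).comp (Lc y)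
  have hG : ContDiffAt ℝ 1 G (φ p) := by
    have h1 : ContDiffAt ℝ 1 Lc (φ p) := hLc.of_le (by simp)
    exact h1.sub ((hSc.fderiv_right (m := 1) (WithTop.coe_le_coe.2 le_top)).clm_comp h1)
  obtain ⟨K, t, ht, hK⟩ := hG.exists_lipschitzOnWith
  have ht' : ∀ᶠ q in 𝓝 p, φ q ∈ t := continuousAt_extChartAt (I := I) p ht
  have hsrc : ∀ᶠ q in 𝓝 p, q ∈ φ.source := extChartAt_source_mem_nhds (I := I) p
  have hdiff : ∀ᶠ q in 𝓝 p, DifferentiableAt ℝ Sc (φ q) := by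
    have h1 := ((hSc.of_le (by simp : (1 : ℕ∞ω) ≤ ∞)).eventually (by simp)).mono
      fun y hy => hy.differentiableAt (by simp)
    exact (continuousAt_extChartAt (I := I) p).eventually h1
  have hGS : ∀ᶠ q in 𝓝 p, G (φ (s (pr q))) = 0 := by
    filter_upwards [hScont.eventually hsrc, hScont.eventually hdiff, hScont.eventually hLe]
      with q hq₁ hq₂ hq₃
    refine ContinuousLinearMap.ext fun v => ?_
    obtain ⟨ξ, hξ, hξv⟩ := hq₃.2 v
    obtain ⟨a, rfl⟩ := htan _ hξ
    have hsd := ((hs (pr q)).mdifferentiableAt (by simp)).hasMFDerivAt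
    have h1 := (hasMFDerivAt_extChartAt hq₁).comp (pr q) hsd
    have h2 := hq₂.hasFDerivAt.hasMFDerivAt.comp (pr q) h1
    have hev : Sc ∘ (extChartAt I p ∘ s) =ᶠ[𝓝 (pr q)] extChartAt I p ∘ s := by
      filter_upwards [hs.continuous.continuousAt.preimage_mem_nhds
        ((isOpen_extChartAt_source (I := I) p).mem_nhds hq₁)] with u hu
      change φ (s (pr (φ.symm (φ (s u))))) = φ (s u)
      rw [φ.left_inv hu, hps]
    have h3 := hasMFDerivAt_unique h2 (h1.congr_of_eventuallyEq hev)
    have h4 := DFunLike.congr_fun h3 a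
    have h5 : Lc (φ (s (pr q))) = L (s (pr q)) := by
      change L (φ.symm (φ (s (pr q)))) = _
      rw [φ.left_inv hq₁]
    change Lc (φ (s (pr q))) v - fderiv ℝ Sc (φ (s (pr q))) (Lc (φ (s (pr q))) v) = 0
    rw [h5]
    refine sub_eq_zero.2 ?_
    rw [← hξv]
    exact h4.symm
  refine eventually_of_eventually_extChartAt_symm (I' := I') ?_
  have key := eventually_eq_zero_of_norm_fderiv_le (K := K)
    (δ := fun z => φ (ψ ((extChartAt I' x₀).symm z)) - Sc (φ (ψ ((extChartAt I' x₀).symm z))))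
    (δ' := fun z => G (φ (ψ ((extChartAt I' x₀).symm z))))
    (x₀ := extChartAt I' x₀ x₀) (by
      filter_upwards [e, tψ.eventually hdiff, tψ.eventually ht', tψ.eventually hGS,
        (hScont.comp tψ).eventually ht'] with z hz₁ hz₂ hz₃ hz₄ hz₅
      have hLz : Lc (φ (ψ ((extChartAt I' x₀).symm z))) = L (ψ ((extChartAt I' x₀).symm z)) := by
        change L (φ.symm (φ _)) = _
        rw [φ.left_inv hz₁.1]
      have hSz : Sc (φ (ψ ((extChartAt I' x₀).symm z))) =
          φ (s (pr (ψ ((extChartAt I' x₀).symm z)))) := by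
        change φ (s (pr (φ.symm (φ _)))) = _
        rw [φ.left_inv hz₁.1]
      constructor
      · refine (hz₁.2.sub (hz₂.hasFDerivAt.comp z hz₁.2)).congr_fderiv ?_
        change _ = Lc _ - (fderiv ℝ Sc _).comp (Lc _)
        rw [hLz]
      · have := hK.dist_le_mul _ hz₃ _ hz₅
        rw [dist_eq_norm, dist_eq_norm] at this
        simp only [Function.comp_apply] at this
        rw [hz₄, sub_zero, ← hSz] at this
        exact this) (by
      have h0 : ψ ((extChartAt I' x₀).symm (extChartAt I' x₀ x₀)) = p := by simpa using hp
      simp only [h0, Sc]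
      rw [φ.left_inv (mem_extChartAt_source p), hSp, sub_self])
  filter_upwards [key, e, (hScont.comp tψ).eventually hsrc] with z hz hz₁ hz₂
  have hSz : Sc (φ (ψ ((extChartAt I' x₀).symm z))) =
      φ (s (pr (ψ ((extChartAt I' x₀).symm z)))) := by
    change φ (s (pr (φ.symm (φ _)))) = _
    rw [φ.left_inv hz₁.1]
  rw [hSz] at hz
  exact ((extChartAt I p).injOn hz₁.1 hz₂ (sub_eq_zero.1 hz)).symm

end Uniqueness

section Domains

variable {V : Type*} [NormedAddCommGroup V] [InnerProductSpace ℝ V] {H : Type*}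
  [TopologicalSpace H] {I : ModelWithCorners ℝ V H} {P : Type*} [TopologicalSpace P]
  [ChartedSpace H P]

theorem boundary_image_closedBall [I.Boundaryless] {x₀ : P} {c : V} {t : ℝ} (ht : 0 < t)
    (hsub : Metric.closedBall c t ⊆ (extChartAt I x₀).target) :
    (extChartAt I x₀).symm '' Metric.closedBall c t \
      interior ((extChartAt I x₀).symm '' Metric.closedBall c t) =
      (extChartAt I x₀).symm '' Metric.sphere c t := by
  set χ := extChartAt I x₀
  ext y
  constructor
  · rintro ⟨⟨z, hz, rfl⟩, hy⟩
    refine ⟨z, ?_, rfl⟩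
    by_contra hne
    have hz' : z ∈ Metric.ball c t :=
      lt_of_le_of_ne (Metric.mem_closedBall.1 hz) hne
    refine hy (mem_interior.2 ⟨χ.source ∩ χ ⁻¹' Metric.ball c t, ?_, ?_, ?_⟩)
    · rintro x ⟨hx, hx'⟩
      exact ⟨χ x, Metric.ball_subset_closedBall hx', χ.left_inv hx⟩
    · exact (continuousOn_extChartAt x₀).isOpen_inter_preimage (isOpen_extChartAt_source x₀)
        Metric.isOpen_ball
    · exact ⟨χ.map_target (hsub hz), by simpa [χ.right_inv (hsub hz)] using hz'⟩
  · rintro ⟨z, hz, rfl⟩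
    refine ⟨⟨z, Metric.sphere_subset_closedBall hz, rfl⟩, fun hy => ?_⟩
    have hzt := hsub (Metric.sphere_subset_closedBall hz)
    have hopen : IsOpen (χ.target ∩ χ.symm ⁻¹' interior (χ.symm '' Metric.closedBall c t)) :=
      (continuousOn_extChartAt_symm x₀).isOpen_inter_preimage (isOpen_extChartAt_target x₀)
        isOpen_interior
    have hint : z ∈ interior (Metric.closedBall c t) := by
      refine mem_interior.2 ⟨_, ?_, hopen, hzt, hy⟩
      rintro w ⟨hw, hw'⟩
      obtain ⟨w', hw'₁, hw'₂⟩ := interior_subset hw'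
      rwa [← χ.symm.injOn (hsub hw'₁) hw hw'₂]
    rw [interior_closedBall c ht.ne'] at hint
    exact absurd (Metric.mem_sphere.1 hz) (Metric.mem_ball.1 hint).ne

/-- Closed balls in charts are domains with boundary. -/
theorem isDomainWithBoundary_image_closedBall [IsManifold I ∞ P] [I.Boundaryless] [Nontrivial V]
    {x₀ : P} {c : V} {t : ℝ} (ht : 0 < t)
    (hsub : Metric.closedBall c t ⊆ (extChartAt I x₀).target) :
    IsDomainWithBoundary I ((extChartAt I x₀).symm '' Metric.closedBall c t) := by
  set χ := extChartAt I x₀ with hχ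
  refine ⟨?_, ?_, ?_⟩
  · refine IsConnected.image ?_ _ ((continuousOn_extChartAt_symm x₀).mono hsub)
    exact (convex_closedBall c t).isConnected ⟨c, Metric.mem_closedBall_self ht.le⟩
  · rw [boundary_image_closedBall ht hsub]
    exact ((NormedSpace.sphere_nonempty).2 ht.le).image _
  · rw [boundary_image_closedBall ht hsub]
    rintro x ⟨z, hz, rfl⟩
    have hzt := hsub (Metric.sphere_subset_closedBall hz)
    have hzn : ‖z - c‖ = t := mem_sphere_iff_norm.1 hz
    let ρ : V → ℝ := fun y => ‖y - c‖ ^ 2 - t ^ 2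
    have hρ : ContDiff ℝ ∞ ρ :=
      ((contDiff_id.sub contDiff_const).norm_sq ℝ).sub contDiff_const
    have hg : ContMDiffOn I 𝓘(ℝ, ℝ) ∞ (fun y => ρ (χ y)) χ.source := by
      refine hρ.contMDiff.comp_contMDiffOn ?_
      have := contMDiffOn_extChartAt (I := I) (n := ∞) (x := x₀)
      rwa [← extChartAt_source I x₀] at this
    refine ⟨χ.source, fun y => ρ (χ y), isOpen_extChartAt_source x₀, χ.map_target hzt, hg, ?_, ?_,
      ?_⟩
    · change ‖χ (χ.symm z) - c‖ ^ 2 - t ^ 2 = 0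
      rw [χ.right_inv hzt, hzn, sub_self]
    · intro h0
      have h1 := hasMFDerivAt_extChartAt_symm hzt
      have h2 := (((hg.contMDiffAt ((isOpen_extChartAt_source x₀).mem_nhds
        (χ.map_target hzt))).mdifferentiableAt (by simp)).hasMFDerivAt).comp z h1
      rw [h0] at h2
      have hev : (ρ : V → ℝ) =ᶠ[𝓝 z] (fun y => ρ (χ y)) ∘ χ.symm := by
        filter_upwards [(isOpen_extChartAt_target x₀).mem_nhds hzt] with y hy
        simp only [Function.comp_apply, χ.right_inv hy]
      have h3 := hasMFDerivAt_iff_hasFDerivAt.1 (h2.congr_of_eventuallyEq hev)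
      have h4 : HasFDerivAt ρ (2 • (innerSL ℝ (z - c)).comp (ContinuousLinearMap.id ℝ V)) z :=
        (((hasFDerivAt_id z).sub_const c).norm_sq).sub_const _
      have h5 := DFunLike.congr_fun (h4.unique h3) (z - c)
      have h6 : 2 * (t * t) = 0 := by
        have : (2 • (innerSL ℝ (z - c)).comp (ContinuousLinearMap.id ℝ V)) (z - c) = 2 * (t * t) := by
          change 2 • inner ℝ (z - c) (z - c) = 2 * (t * t)
          rw [real_inner_self_eq_norm_sq, hzn, sq, nsmul_eq_mul, Nat.cast_ofNat]
        rw [← this]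
        exact h5
      nlinarith
    · ext y
      constructor
      · rintro ⟨⟨w, hw, rfl⟩, hy⟩
        refine ⟨hy, ?_⟩
        simp only [ρ, χ.right_inv (hsub hw)]
        have := mem_closedBall_iff_norm.1 hw
        nlinarith [norm_nonneg (w - c)]
      · rintro ⟨hy, hy'⟩
        refine ⟨⟨χ y, ?_, χ.left_inv hy⟩, hy⟩
        rw [mem_closedBall_iff_norm]
        exact (sq_le_sq₀ (norm_nonneg _) ht.le).1 (sub_nonpos.1 hy')

/-- Each point of a ball, other than the given boundary point `c + r • e`, lies on a sphere which
touches the boundary of the ball from inside at that boundary point. -/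
theorem exists_mem_sphere_of_mem_ball {c e y : V} {r : ℝ} (hr : 0 ≤ r)
    (hy : y ∈ Metric.ball c r) (hye : y ≠ c + r • e) :
    ∃ t, 0 < t ∧ t ≤ r ∧ y ∈ Metric.sphere (c + (r - t) • e) t := by
  have hcont : ContinuousOn (fun t : ℝ => ‖y - (c + (r - t) • e)‖ - t) (Icc 0 r) := by fun_prop
  have h0 : (0 : ℝ) ∈ Icc (‖y - (c + (r - r) • e)‖ - r) (‖y - (c + (r - 0) • e)‖ - 0) := by
    constructor
    · have := (mem_ball_iff_norm.1 hy).le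
      simpa using this
    · simp
  obtain ⟨t, ht, hty⟩ := intermediate_value_Icc' hr hcont h0
  refine ⟨t, lt_of_le_of_ne ht.1 ?_, ht.2, mem_sphere_iff_norm.2 (sub_eq_zero.1 hty)⟩
  rintro rfl
  simp only [sub_zero, norm_eq_zero, sub_eq_zero] at hty
  exact hye hty

end Domains

section Topology

theorem isOpen_setOf_mem_and_eq {X Y : Type*} [TopologicalSpace X] {U : Set X}
    (hU : IsOpen U) {a b : X → Y} (hloc : ∀ x ∈ U, a x = b x → ∀ᶠ y in 𝓝 x, a y = b y) :
    IsOpen {x ∈ U | a x = b x} := by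
  rw [isOpen_iff_mem_nhds]
  rintro y ⟨hy, hy'⟩
  filter_upwards [hU.mem_nhds hy, hloc y hy hy'] with z hz hz' using ⟨hz, hz'⟩

/-- Two continuous maps which agree near each point where they agree, agree on a connected set on
which they agree somewhere. -/
theorem IsPreconnected.eqOn_of_eventuallyEq {X Y : Type*} [TopologicalSpace X]
    [TopologicalSpace Y] [T2Space Y] {N U : Set X} (hN : IsPreconnected N) (hU : IsOpen U)
    (hNU : N ⊆ U) {a b : X → Y} (ha : ContinuousOn a U) (hb : ContinuousOn b U)
    (hloc : ∀ x ∈ U, a x = b x → ∀ᶠ y in 𝓝 x, a y = b y) {x : X} (hx : x ∈ N)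
    (hab : a x = b x) : EqOn a b N := by
  have h1 : IsOpen {x ∈ U | a x = b x} := isOpen_setOf_mem_and_eq hU hloc
  have h2 : IsOpen (U ∩ (fun x => (a x, b x)) ⁻¹' (diagonal Y)ᶜ) :=
    (ha.prodMk hb).isOpen_inter_preimage hU isClosed_diagonal.isOpen_compl
  have h3 := hN.subset_left_of_subset_union h1 h2 (by
    rw [disjoint_left]
    rintro y ⟨-, hy⟩ ⟨-, hy'⟩
    exact hy' hy) (by
    intro y hy
    by_cases h : a y = b y
    · exact Or.inl ⟨hNU hy, h⟩
    · exact Or.inr ⟨hNU hy, h⟩) ⟨x, hx, hNU hx, hab⟩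
  exact fun y hy => (h3 hy).2

theorem FiberBundle.t2Space_totalSpace {B F : Type*} [TopologicalSpace B] [TopologicalSpace F]
    {E : B → Type*} [TopologicalSpace (Bundle.TotalSpace F E)] [∀ b, TopologicalSpace (E b)]
    [FiberBundle F E] [T2Space B] [T2Space F] : T2Space (Bundle.TotalSpace F E) := by
  refine ⟨fun p q hpq => ?_⟩
  by_cases h : p.proj = q.proj
  · let e := trivializationAt F E p.proj
    have hp : p ∈ e.source := FiberBundle.mem_trivializationAt_proj_source
    have hq : q ∈ e.source := by
      rw [e.mem_source, ← h]
      exact FiberBundle.mem_baseSet_trivializationAt' _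
    obtain ⟨u, v, hu, hv, hpu, hqv, huv⟩ :=
      t2_separation (fun h' => hpq (e.injOn hp hq h'))
    refine ⟨e.source ∩ e ⁻¹' u, e.source ∩ e ⁻¹' v, e.continuousOn.isOpen_inter_preimage
      e.open_source hu, e.continuousOn.isOpen_inter_preimage e.open_source hv, ⟨hp, hpu⟩,
      ⟨hq, hqv⟩, ?_⟩
    exact (huv.preimage e).mono inter_subset_right inter_subset_right
  · have hc : Continuous (Bundle.TotalSpace.proj : Bundle.TotalSpace F E → B) :=
      FiberBundle.continuous_proj F E
    obtain ⟨u, v, hu, hv, hpu, hqv, huv⟩ := t2_separation h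
    exact ⟨_, _, hu.preimage hc, hv.preimage hc, hpu, hqv, huv.preimage _⟩

end Topology

section BundleSmoothness

variable {m n : ℕ} {M E : Type*} [TopologicalSpace M] [ChartedSpace (BaseModel m) M]
  [TopologicalSpace E] [ChartedSpace (TotModel m n) E]

theorem FibredManifold.contMDiff [IsManifold 𝓘(ℝ, BaseModel m) ∞ M]
    [IsManifold 𝓘(ℝ, TotModel m n) ∞ E] (π : E → M) [FibredManifold m n π] :
    ContMDiff 𝓘(ℝ, TotModel m n) 𝓘(ℝ, BaseModel m) ∞ π := by
  intro u
  obtain ⟨φ, hφ, hu⟩ := FibredManifold.adapted (m := m) (n := n) (π := π)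
    (chartAt (TotModel m n) u) (chart_mem_atlas _ u)
  have h1 : ContMDiffAt 𝓘(ℝ, TotModel m n) 𝓘(ℝ, TotModel m n) ∞ (chartAt (TotModel m n) u) u :=
    (contMDiffOn_chart (I := 𝓘(ℝ, TotModel m n))).contMDiffAt (chart_source_mem_nhds _ u)
  have h2 : ContMDiffAt 𝓘(ℝ, TotModel m n) 𝓘(ℝ, BaseModel m) ∞
      (fun x => (chartAt (TotModel m n) u x).1) u :=
    (contDiff_fst.contMDiff (n := ∞)).contMDiffAt.comp u h1
  have hsrc := mem_chart_source (TotModel m n) u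
  have h3 : ContMDiffAt 𝓘(ℝ, BaseModel m) 𝓘(ℝ, BaseModel m) ∞ φ.symm
      (chartAt (TotModel m n) u u).1 :=
    (contMDiffOn_symm_of_mem_maximalAtlas hφ).contMDiffAt (φ.open_target.mem_nhds (by
      rw [(hu u hsrc).2]; exact φ.map_source (hu u hsrc).1))
  refine (ContMDiffAt.comp u h3 h2).congr_of_eventuallyEq ?_
  filter_upwards [chart_source_mem_nhds (TotModel m n) u] with x hx
  simp only [Function.comp_apply, (hu x hx).2, φ.left_inv (hu x hx).1]

variable [IsManifold 𝓘(ℝ, TotModel m n) ∞ E] (π : E → M) [FibredManifold m n π]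

theorem contMDiff_resDual_proj : ContMDiff (resModel m n) 𝓘(ℝ, TotModel m n) ∞
    (Bundle.TotalSpace.proj : ResDual m n π → E) :=
  Bundle.contMDiff_proj _

theorem contMDiff_projBase [IsManifold 𝓘(ℝ, BaseModel m) ∞ M] :
    ContMDiff (resModel m n) 𝓘(ℝ, BaseModel m) ∞ (projBase m n π) :=
  (FibredManifold.contMDiff π).comp (contMDiff_resDual_proj π)

variable {π} in
theorem DualSection.contMDiff_toMap (s : DualSection m n π) :
    ContMDiff 𝓘(ℝ, TotModel m n) (resModel m n) ∞ s.toMap :=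
  s.contMDiff

theorem t2Space_resDual [T2Space E] : T2Space (ResDual m n π) :=
  FiberBundle.t2Space_totalSpace

end BundleSmoothness

section LocalForm

variable {m n : ℕ} {M E : Type*} [TopologicalSpace M] [ChartedSpace (BaseModel m) M]
  [TopologicalSpace E] [ChartedSpace (TotModel m n) E]
  [IsManifold 𝓘(ℝ, TotModel m n) ∞ E] {π : E → M} [FibredManifold m n π]

/-- The coordinate expression of a point of `Λᵐ₂(T*E)` as a form on the model. -/
theorem inclForm_trivializationAt (q : ExtDual m n π) {x₀ : E}
    (hq : q.proj ∈ (chartAt (TotModel m n) x₀).source) :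
    inclForm m n (trivializationAt (ExtFibre m n) (extCore m n π).Fiber x₀ q).2 =
      (toForm m n π q).compContinuousLinearMap
        (mfderiv 𝓘(ℝ, TotModel m n) 𝓘(ℝ, TotModel m n)
          (extChartAt 𝓘(ℝ, TotModel m n) x₀).symm (extChartAt 𝓘(ℝ, TotModel m n) x₀ q.proj) :
            TotModel m n →L[ℝ] TotModel m n) := by
  have h1 := TangentBundle.symmL_trivializationAt (I := 𝓘(ℝ, TotModel m n)) hq
  rw [TangentBundle.symmL_trivializationAt_eq_core hq, ModelWithCorners.range_eq_univ,
    mfderivWithin_univ] at h1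
  have h2 := preservesVertical_coordChange m n π (achart (TotModel m n) x₀)
    (achart (TotModel m n) q.proj) hq (mem_chart_source _ _)
  refine (pullExt_coe ((tangentBundleCore 𝓘(ℝ, TotModel m n) E).coordChange
    (achart (TotModel m n) x₀) (achart (TotModel m n) q.proj) q.proj) q.2).trans ?_
  rw [lowerTri_eq h2]
  exact congrArg (ContinuousAlternatingMap.compContinuousLinearMap (toForm m n π q)) h1

theorem resMk_trivializationAt (q : ExtDual m n π) (x₀ : E) :
    resMk m n (trivializationAt (ExtFibre m n) (extCore m n π).Fiber x₀ q).2 =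
      (trivializationAt (ResFibre m n) (resCore m n π).Fiber x₀ (quotientMap m n π q)).2 :=
  rfl

/-- The coordinate expression of a Hamiltonian section. -/
noncomputable def localSection (h : ResDual m n π → ExtDual m n π) (p : ResDual m n π)
    (y : TotModel m n × ResFibre m n) : ExtFibre m n :=
  (trivializationAt (ExtFibre m n) (extCore m n π).Fiber p.proj
    (h ((extChartAt (resModel m n) p).symm y))).2

variable {h : ResDual m n π → ExtDual m n π}

theorem IsHamiltonianSection.proj_eq (hh : IsHamiltonianSection m n π h) (p : ResDual m n π) :
    (h p).proj = p.proj :=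
  congrArg Bundle.TotalSpace.proj (hh.2 p)

theorem contDiffAt_localSection (hh : IsHamiltonianSection m n π h) (p : ResDual m n π) :
    ContDiffAt ℝ ∞ (localSection h p) (extChartAt (resModel m n) p p) := by
  refine contDiffAt_comp_extChartAt_symm (I := resModel m n) (g := fun q =>
    (trivializationAt (ExtFibre m n) (extCore m n π).Fiber p.proj (h q)).2) ?_
  have h1 := ((Bundle.contMDiffAt_totalSpace).1 (hh.1 p)).2
  rwa [hh.proj_eq p] at h1

theorem extChartAt_resDual_symm_proj (p : ResDual m n π) (y : TotModel m n × ResFibre m n)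
    (hy : y ∈ (extChartAt (resModel m n) p).target) :
    ((extChartAt (resModel m n) p).symm y).proj =
        (extChartAt 𝓘(ℝ, TotModel m n) p.proj).symm y.1 ∧
      y.1 ∈ (extChartAt 𝓘(ℝ, TotModel m n) p.proj).target ∧
      (trivializationAt (ResFibre m n) (resCore m n π).Fiber p.proj
        ((extChartAt (resModel m n) p).symm y)).2 = y.2 := by
  have hy' := hy
  rw [FiberBundle.extChartAt_target] at hy'
  obtain ⟨⟨hy1, hy2⟩, -⟩ := hy'
  have hs : (extChartAt (resModel m n) p).symm y =
      (trivializationAt (ResFibre m n) (resCore m n π).Fiber p.proj).toOpenPartialHomeomorph.symm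
        ((extChartAt 𝓘(ℝ, TotModel m n) p.proj).symm y.1, y.2) := by
    rw [FiberBundle.extChartAt]
    rfl
  rw [hs]
  refine ⟨Bundle.Trivialization.proj_symm_apply' _ hy2, hy1, ?_⟩
  rw [Bundle.Trivialization.apply_symm_apply' _ hy2]

theorem resMk_localSection (hh : IsHamiltonianSection m n π h) (p : ResDual m n π)
    {y : TotModel m n × ResFibre m n} (hy : y ∈ (extChartAt (resModel m n) p).target) :
    resMk m n (localSection h p y) = y.2 := by
  rw [localSection, resMk_trivializationAt, hh.2]
  exact (extChartAt_resDual_symm_proj p y hy).2.2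

/-- The coordinate expression of `h*Θ`. -/
theorem pullback_liouvilleForm_extChartAt (hh : IsHamiltonianSection m n π h) (p : ResDual m n π)
    {y : TotModel m n × ResFibre m n} (hy : y ∈ (extChartAt (resModel m n) p).target) :
    ((pullback (resModel m n) (extModel m n) h (liouvilleForm m n π)
      ((extChartAt (resModel m n) p).symm y)).compContinuousLinearMap
      (mfderivWithin 𝓘(ℝ, TotModel m n × ResFibre m n) (resModel m n)
        (extChartAt (resModel m n) p).symm (range (resModel m n)) y) :
          (TotModel m n × ResFibre m n) [⋀^Fin m]→L[ℝ] ℝ) =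
      (inclForm m n (localSection h p y)).compContinuousLinearMap
        (ContinuousLinearMap.fst ℝ (TotModel m n) (ResFibre m n)) := by
  obtain ⟨hproj, hy1, -⟩ := extChartAt_resDual_symm_proj p y hy
  set z := (extChartAt (resModel m n) p).symm y with hz
  have hq : (h z).proj = (extChartAt 𝓘(ℝ, TotModel m n) p.proj).symm y.1 :=
    (hh.proj_eq z).trans hproj
  have hqs : (h z).proj ∈ (chartAt (TotModel m n) p.proj).source := by
    rw [hq, ← extChartAt_source 𝓘(ℝ, TotModel m n)]
    exact (extChartAt 𝓘(ℝ, TotModel m n) p.proj).map_target hy1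
  have hqy : extChartAt 𝓘(ℝ, TotModel m n) p.proj (h z).proj = y.1 := by
    rw [hq]; exact (extChartAt 𝓘(ℝ, TotModel m n) p.proj).right_inv hy1
  have h0 := inclForm_trivializationAt (h z) hqs
  rw [hqy] at h0
  have h1 := hasMFDerivAt_extChartAt_symm hy
  have h2 := ((hh.1 z).mdifferentiableAt (by simp)).hasMFDerivAt
  have h3 := ((Bundle.contMDiff_proj (n := ∞) (IB := 𝓘(ℝ, TotModel m n)) (F := ExtFibre m n)
    (extCore m n π).Fiber (h z)).mdifferentiableAt (by simp)).hasMFDerivAt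
  have h4 := h3.comp y (h2.comp y h1)
  have h5 := (hasMFDerivAt_extChartAt_symm hy1).comp y
    (ContinuousLinearMap.fst ℝ (TotModel m n) (ResFibre m n)).hasFDerivAt.hasMFDerivAt
  have hev : (Bundle.TotalSpace.proj ∘ h ∘ (extChartAt (resModel m n) p).symm) =ᶠ[𝓝 y]
      (extChartAt 𝓘(ℝ, TotModel m n) p.proj).symm ∘
        ContinuousLinearMap.fst ℝ (TotModel m n) (ResFibre m n) := by
    filter_upwards [(isOpen_extChartAt_target p).mem_nhds hy] with w hw
    exact (hh.proj_eq _).trans (extChartAt_resDual_symm_proj p w hw).1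
  have h6 := hasMFDerivAt_unique h4 (h5.congr_of_eventuallyEq hev)
  rw [ModelWithCorners.range_eq_univ, mfderivWithin_univ]
  rw [localSection, h0]
  exact congrArg (ContinuousAlternatingMap.compContinuousLinearMap (toForm m n π (h z))) h6

theorem fst_eq_mfderiv_proj (p : ResDual m n π) (ξ : TangentSpace (resModel m n) p) :
    Prod.fst (α := TotModel m n) (β := ResFibre m n) ξ =
      mfderiv (resModel m n) 𝓘(ℝ, TotModel m n) Bundle.TotalSpace.proj p ξ := by
  have h1 := hasMFDerivAt_extChartAt (I := resModel m n) (mem_extChartAt_source p)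
  have h2 := (ContinuousLinearMap.fst ℝ (TotModel m n) (ResFibre m n)).hasFDerivAt.hasMFDerivAt.comp
    p h1
  have h3 := ((contMDiff_resDual_proj π p).mdifferentiableAt (by simp)).hasMFDerivAt
  have h4 := (hasMFDerivAt_extChartAt (I := 𝓘(ℝ, TotModel m n))
    (mem_extChartAt_source p.proj)).comp p h3
  have hev : (extChartAt 𝓘(ℝ, TotModel m n) p.proj ∘ Bundle.TotalSpace.proj) =ᶠ[𝓝 p]
      ContinuousLinearMap.fst ℝ (TotModel m n) (ResFibre m n) ∘ extChartAt (resModel m n) p := by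
    refine Filter.Eventually.of_forall fun q => ?_
    rw [FiberBundle.extChartAt]
    rfl
  have h5 := hasMFDerivAt_unique h4 (h2.congr_of_eventuallyEq hev)
  rw [mfderiv_extChartAt_self, mfderiv_extChartAt_self] at h5
  exact (DFunLike.congr_fun h5 ξ).symm

theorem alternatizeUncurryFin_apply_cons_of_fst_eq_zero {A B : Type*} [NormedAddCommGroup A]
    [NormedSpace ℝ A] [NormedAddCommGroup B] [NormedSpace ℝ B] {k : ℕ}
    (δ : A × B →L[ℝ] A [⋀^Fin k]→L[ℝ] ℝ) {w : A × B} (hw : w.1 = 0) (v : Fin k → A × B) :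
    ContinuousAlternatingMap.alternatizeUncurryFin
      ((ContinuousAlternatingMap.compContinuousLinearMapCLM (ContinuousLinearMap.fst ℝ A B)).comp δ)
      (Fin.cons w v) = δ w (fun i => (v i).1) := by
  rw [ContinuousAlternatingMap.alternatizeUncurryFin_apply, Fin.sum_univ_succ,
    Finset.sum_eq_zero, add_zero]
  · simp [Function.comp_def]
  · intro i _
    obtain ⟨k, rfl⟩ : ∃ l, k = l + 1 := ⟨k - 1, by have := i.2; omega⟩
    have : (δ (v i)) (fun j => (Fin.removeNth (α := fun _ => A × B) i.succ (Fin.cons w v) j).1) = 0 :=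
      (δ (v i)).map_coord_zero 0 (by simpa [Fin.removeNth] using hw)
    simpa [Function.comp_def] using this

/-- `Ω_h` contracted with a vector tangent to the fibres of `J¹π* → E`. -/
theorem hamiltonCartan_apply_cons_of_vertical (hh : IsHamiltonianSection m n π h)
    {p : ResDual m n π} {w : TangentSpace (resModel m n) p}
    (hw : mfderiv (resModel m n) 𝓘(ℝ, TotModel m n) Bundle.TotalSpace.proj p w = 0)
    (v : Fin m → TangentSpace (resModel m n) p) :
    hamiltonCartan m n π h p (Fin.cons (α := fun _ => TangentSpace (resModel m n) p) w v) =
      -inclForm m n (fderiv ℝ (localSection h p) (extChartAt (resModel m n) p p) w)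
        (fun i => mfderiv (resModel m n) 𝓘(ℝ, TotModel m n) Bundle.TotalSpace.proj p (v i)) := by
  let ι := (inclForm m n).toContinuousLinearMap
  let δ := fderiv ℝ (localSection h p) (extChartAt (resModel m n) p p)
  let c : ((TotModel m n) [⋀^Fin m]→L[ℝ] ℝ) →L[ℝ] (TotModel m n × ResFibre m n) [⋀^Fin m]→L[ℝ] ℝ :=
    ContinuousAlternatingMap.compContinuousLinearMapCLM
      (ContinuousLinearMap.fst ℝ (TotModel m n) (ResFibre m n))
  have hδ : HasFDerivAt (localSection h p) δ (extChartAt (resModel m n) p p) :=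
    ((contDiffAt_localSection hh p).differentiableAt (by simp)).hasFDerivAt
  have hcδ : HasFDerivAt (fun y => c (ι (localSection h p y))) (c.comp (ι.comp δ))
      (extChartAt (resModel m n) p p) := c.hasFDerivAt.comp _ (ι.hasFDerivAt.comp _ hδ)
  have h1 : extDiff (resModel m n) (pullback (resModel m n) (extModel m n) h
      (liouvilleForm m n π)) p =
      ContinuousAlternatingMap.alternatizeUncurryFin (c.comp (ι.comp δ)) := by
    rw [extDiff, mfderiv_extChartAt_self]
    change extDerivWithin (𝕜 := ℝ) (E := TotModel m n × ResFibre m n) (F := ℝ) _ _ _ = _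
    rw [← hcδ.fderiv, ← extDeriv, ModelWithCorners.range_eq_univ, extDerivWithin_univ]
    refine Filter.EventuallyEq.extDeriv_eq ?_
    filter_upwards [extChartAt_target_mem_nhds (I := resModel m n) p] with y hy
    have := pullback_liouvilleForm_extChartAt hh p hy
    rw [ModelWithCorners.range_eq_univ] at this
    exact this
  have h2 := alternatizeUncurryFin_apply_cons_of_fst_eq_zero (ι.comp δ)
    ((fst_eq_mfderiv_proj p w).trans hw) v
  rw [hamiltonCartan, h1]
  refine congrArg Neg.neg (h2.trans ?_)
  exact congrArg (inclForm m n (δ w)) (funext fun i => fst_eq_mfderiv_proj p (v i))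

/-- A vector tangent to the fibres of `J¹π* → E` which is `Ω_h`-orthogonal to a subspace projecting
onto the tangent space of `E` vanishes. -/
theorem eq_zero_of_vertical_of_orthogonal (hh : IsHamiltonianSection m n π h) {p : ResDual m n π}
    {F : Submodule ℝ (TangentSpace (resModel m n) p)}
    (hF : ∀ a : TotModel m n, ∃ ξ ∈ F,
      mfderiv (resModel m n) 𝓘(ℝ, TotModel m n) Bundle.TotalSpace.proj p ξ = a)
    {w : TangentSpace (resModel m n) p}
    (hw : mfderiv (resModel m n) 𝓘(ℝ, TotModel m n) Bundle.TotalSpace.proj p w = 0)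
    (hort : w ∈ orthogonalComplement (resModel m n) (hamiltonCartan m n π h p) F) : w = 0 := by
  have hdls := ((contDiffAt_localSection hh p).differentiableAt (by simp)).hasFDerivAt
  set δ := fderiv ℝ (localSection h p) (extChartAt (resModel m n) p p) with hδ
  have hδw : δ w = 0 := by
    refine (inclForm m n).injective ?_
    rw [map_zero]
    ext a
    choose v hv hva using fun i => hF (a i)
    have h1 := hort v hv
    rw [hamiltonCartan_apply_cons_of_vertical hh hw, neg_eq_zero] at h1
    exact (congrArg (inclForm m n (δ w)) (funext hva)).symm.trans h1
  have hres : HasFDerivAt (fun y => resMk m n (localSection h p y))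
      ((resMk m n).comp δ) (extChartAt (resModel m n) p p) :=
    (resMk m n).hasFDerivAt.comp _ hdls
  have hev : (fun y => resMk m n (localSection h p y)) =ᶠ[𝓝 (extChartAt (resModel m n) p p)]
      (ContinuousLinearMap.snd ℝ (TotModel m n) (ResFibre m n)) := by
    filter_upwards [extChartAt_target_mem_nhds p] with y hy using resMk_localSection hh p hy
  have h2 := DFunLike.congr_fun (hres.unique
    ((ContinuousLinearMap.snd ℝ _ _).hasFDerivAt.congr_of_eventuallyEq hev)) w
  have h3 : resMk m n (δ w) = 0 := by rw [hδw, map_zero]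
  exact Prod.ext ((fst_eq_mfderiv_proj p w).trans hw) (h2.symm.trans h3)

end LocalForm

section IntegralSections

variable {V : Type*} [NormedAddCommGroup V] [NormedSpace ℝ V] {H : Type*} [TopologicalSpace H]
  {I : ModelWithCorners ℝ V H} {P : Type*} [TopologicalSpace P] [ChartedSpace H P]
  {V' : Type*} [NormedAddCommGroup V'] [NormedSpace ℝ V'] {H' : Type*} [TopologicalSpace H']
  {I' : ModelWithCorners ℝ V' H'} {P' : Type*} [TopologicalSpace P'] [ChartedSpace H' P']
  {V'' : Type*} [NormedAddCommGroup V''] [NormedSpace ℝ V''] {H'' : Type*} [TopologicalSpace H'']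
  {I'' : ModelWithCorners ℝ V'' H''} {P'' : Type*} [TopologicalSpace P''] [ChartedSpace H'' P'']

theorem tangentImage_comp {g : P' → P''} {f : P → P'} {p : P}
    (hg : MDifferentiableAt I' I'' g (f p)) (hf : MDifferentiableAt I I' f p) :
    tangentImage I I'' (g ∘ f) p = (tangentImage I I' f p).map
      (mfderiv I' I'' g (f p) : TangentSpace I' (f p) →ₗ[ℝ] TangentSpace I'' (g (f p))) := by
  rw [tangentImage, tangentImage, mfderiv_comp p hg hf]
  exact LinearMap.range_comp _ _

theorem IsIntegralSection.mono {f : P → P'} {D : Distribution I P} {N N' : Set P'} {σ : P' → P}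
    (h : IsIntegralSection I' f D N σ) (hN : N' ⊆ N) : IsIntegralSection I' f D N' σ := by
  obtain ⟨U, hU, hNU, h⟩ := h
  exact ⟨U, hU, hN.trans hNU, h⟩

theorem IsIntegralSection.congr {f : P → P'} {D : Distribution I P} {N : Set P'}
    {σ τ : P' → P} (h : IsIntegralSection I' f D N σ) (hN : IsOpen N) (hστ : EqOn τ σ N) :
    IsIntegralSection I' f D N τ := by
  obtain ⟨U, hU, hNU, hσ, h⟩ := h
  refine ⟨N, hN, subset_rfl, (hσ.mono hNU).congr hστ, fun x hx => ?_⟩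
  have hD : ∀ p q : P, p = q → (D p : Submodule ℝ V) = (D q : Submodule ℝ V) := by
    rintro p q rfl; rfl
  have hev : τ =ᶠ[𝓝 x] σ := Filter.eventuallyEq_of_mem (hN.mem_nhds hx) hστ
  have h1 : (mfderiv I' I τ x : V' →L[ℝ] V) = (mfderiv I' I σ x : V' →L[ℝ] V) := hev.mfderiv_eq
  have h2 : (tangentImage I' I τ x : Submodule ℝ V) = tangentImage I' I σ x :=
    congrArg (fun A : V' →L[ℝ] V => LinearMap.range (A : V' →ₗ[ℝ] V)) h1
  refine ⟨by rw [hστ hx]; exact (h x (hNU hx)).1, ?_⟩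
  exact h2.trans (((h x (hNU hx)).2).trans (hD _ _ (hστ hx).symm))

end IntegralSections

section HamiltonJacobi

variable {m n : ℕ} {M E : Type*} [TopologicalSpace M] [ChartedSpace (BaseModel m) M]
  [TopologicalSpace E] [ChartedSpace (TotModel m n) E]
  [IsManifold 𝓘(ℝ, TotModel m n) ∞ E] {π : E → M} [FibredManifold m n π]
  {h : ResDual m n π → ExtDual m n π} {D : Distribution (resModel m n) (ResDual m n π)}
  {s : DualSection m n π}

theorem mfderiv_proj_mfderiv_toMap (s : DualSection m n π) (u : E)
    (a : TangentSpace 𝓘(ℝ, TotModel m n) u) :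
    mfderiv (resModel m n) 𝓘(ℝ, TotModel m n) Bundle.TotalSpace.proj (s.toMap u)
      (mfderiv 𝓘(ℝ, TotModel m n) (resModel m n) s.toMap u a) = a := by
  have h1 := ((contMDiff_resDual_proj π (s.toMap u)).mdifferentiableAt (by simp)).hasMFDerivAt.comp
    u ((s.contMDiff_toMap u).mdifferentiableAt (by simp)).hasMFDerivAt
  exact DFunLike.congr_fun (hasMFDerivAt_unique h1 (hasMFDerivAt_id u)) a

/-- An isotropic section is Lagrangian. -/
theorem isLagrangianImage_of_pullback_eq_zero (hh : IsHamiltonianSection m n π h)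
    (hs : pullback 𝓘(ℝ, TotModel m n) (resModel m n) s.toMap (hamiltonCartan m n π h) = 0) :
    IsLagrangianImage 𝓘(ℝ, TotModel m n) (resModel m n) (hamiltonCartan m n π h) s.toMap := by
  intro u
  have hiso : ∀ ξ ∈ tangentImage 𝓘(ℝ, TotModel m n) (resModel m n) s.toMap u,
      ξ ∈ orthogonalComplement (resModel m n) (hamiltonCartan m n π h (s.toMap u))
        (tangentImage 𝓘(ℝ, TotModel m n) (resModel m n) s.toMap u) := by
    rintro ξ ⟨a, rfl⟩ v hv
    choose b hb using hv
    have h1 := DFunLike.congr_fun (congrFun hs u)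
      (Fin.cons (α := fun _ => TangentSpace 𝓘(ℝ, TotModel m n) u) a b)
    refine Eq.trans (congrArg (hamiltonCartan m n π h (s.toMap u)) (funext fun i => ?_)) h1
    refine Fin.cases rfl (fun i => (hb i).symm) i
  refine Subset.antisymm hiso fun ξ hξ => ?_
  let a : TangentSpace 𝓘(ℝ, TotModel m n) u :=
    mfderiv (resModel m n) 𝓘(ℝ, TotModel m n) Bundle.TotalSpace.proj (s.toMap u) ξ
  let η : TangentSpace (resModel m n) (s.toMap u) :=
    mfderiv 𝓘(ℝ, TotModel m n) (resModel m n) s.toMap u a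
  have hη : η ∈ tangentImage 𝓘(ℝ, TotModel m n) (resModel m n) s.toMap u := ⟨a, rfl⟩
  have hz : ξ - η = 0 := by
    refine eq_zero_of_vertical_of_orthogonal hh
      (F := tangentImage 𝓘(ℝ, TotModel m n) (resModel m n) s.toMap u)
      (fun b => ⟨_, ⟨b, rfl⟩, mfderiv_proj_mfderiv_toMap s u b⟩) ?_ ?_
    · rw [map_sub]
      exact sub_eq_zero.2 (mfderiv_proj_mfderiv_toMap s u a).symm
    · intro v hv
      let l := (hamiltonCartan m n π h (s.toMap u)).toContinuousMultilinearMap.toMultilinearMap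
      have h1 := l.cons_add v (ξ - η) η
      rw [sub_add_cancel] at h1
      have h2 : l (Fin.cons ξ v) = 0 := hξ v hv
      have h3 : l (Fin.cons η v) = 0 := hiso η hη v hv
      rw [h2, h3, add_zero] at h1
      exact h1.symm
  rw [sub_eq_zero.1 hz]
  exact hη

/-- The projection to `E` of an integral section with values in `Im s`. -/
theorem isIntegralSection_proj {U Z N : Set M} {ψ : M → ResDual m n π}
    (hψ : ContMDiffOn 𝓘(ℝ, BaseModel m) (resModel m n) ∞ ψ U)
    (hint : ∀ x ∈ U, projBase m n π (ψ x) = x ∧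
      tangentImage 𝓘(ℝ, BaseModel m) (resModel m n) ψ x = D (ψ x))
    (hZ : IsOpen Z) (hZU : Z ⊆ U) (hNZ : N ⊆ Z) (hs : ∀ x ∈ Z, s.toMap (ψ x).proj = ψ x) :
    IsIntegralSection 𝓘(ℝ, BaseModel m) π (projectedDistribution s D) N fun x => (ψ x).proj := by
  refine ⟨Z, hZ, hNZ, (contMDiff_resDual_proj π).comp_contMDiffOn (hψ.mono hZU), fun x hx =>
    ⟨(hint x (hZU hx)).1, ?_⟩⟩
  have h1 := tangentImage_comp ((contMDiff_resDual_proj π (ψ x)).mdifferentiableAt (by simp))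
    (((hψ.mono hZU).contMDiffAt (hZ.mem_nhds hx)).mdifferentiableAt (by simp))
  rw [(hint x (hZU hx)).2] at h1
  have h2 : ∀ p q : ResDual m n π, p = q →
      ((D p).map (mfderiv (resModel m n) 𝓘(ℝ, TotModel m n) Bundle.TotalSpace.proj p :
        TangentSpace (resModel m n) p →ₗ[ℝ] TangentSpace 𝓘(ℝ, TotModel m n) p.proj) :
          Submodule ℝ (TotModel m n)) =
      (D q).map (mfderiv (resModel m n) 𝓘(ℝ, TotModel m n) Bundle.TotalSpace.proj q :
        TangentSpace (resModel m n) q →ₗ[ℝ] TangentSpace 𝓘(ℝ, TotModel m n) q.proj) := by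
    rintro p q rfl; rfl
  exact h1.trans (h2 _ _ (hs x hx).symm)

/-- If `D` is tangent to `Im s`, then `s` maps integral sections to integral sections. -/
theorem IsTangentTo.isIntegralSection_toMap (hT : IsTangentTo D s) {N : Set M} {γ : M → E}
    (hγ : IsIntegralSection 𝓘(ℝ, BaseModel m) π (projectedDistribution s D) N γ) :
    IsIntegralSection 𝓘(ℝ, BaseModel m) (projBase m n π) D N fun x => s.toMap (γ x) := by
  obtain ⟨U, hU, hNU, hγ, hint⟩ := hγ
  refine ⟨U, hU, hNU, s.contMDiff_toMap.comp_contMDiffOn hγ, fun x hx => ⟨(hint x hx).1, ?_⟩⟩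
  have h1 := tangentImage_comp ((s.contMDiff_toMap (γ x)).mdifferentiableAt (by simp))
    ((hγ.contMDiffAt (hU.mem_nhds hx)).mdifferentiableAt (by simp))
  rw [(hint x hx).2] at h1
  refine h1.trans (Submodule.ext fun ξ => ⟨?_, fun hξ => ?_⟩)
  · rintro ⟨a, ⟨ξ, hξ, rfl⟩, rfl⟩
    obtain ⟨a, rfl⟩ := hT _ hξ
    have h2 := mfderiv_proj_mfderiv_toMap s (γ x) a
    have h3 := congrArg (mfderiv 𝓘(ℝ, TotModel m n) (resModel m n) s.toMap (γ x)) h2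
    exact h3.symm ▸ hξ
  · obtain ⟨a, rfl⟩ := hT _ hξ
    exact ⟨a, ⟨_, hξ, mfderiv_proj_mfderiv_toMap s (γ x) a⟩, rfl⟩

/-- If `s` maps a section of `E` to an integral section of `D`, then `D` is tangent to `Im s` along
this section. -/
theorem le_tangentImage_of_isIntegralSection_toMap {N : Set M} {γ : M → E} {x : M} (hx : x ∈ N)
    (h : IsIntegralSection 𝓘(ℝ, BaseModel m) (projBase m n π) D N fun x => s.toMap (γ x))
    (hγ : MDifferentiableAt 𝓘(ℝ, BaseModel m) 𝓘(ℝ, TotModel m n) γ x) :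
    D (s.toMap (γ x)) ≤ tangentImage 𝓘(ℝ, TotModel m n) (resModel m n) s.toMap (γ x) := by
  obtain ⟨U, hU, hNU, -, hint⟩ := h
  have h1 := tangentImage_comp ((s.contMDiff_toMap (γ x)).mdifferentiableAt (by simp)) hγ
  rw [← (hint x (hNU hx)).2]
  refine h1.le.trans ?_
  rintro _ ⟨a, -, rfl⟩
  exact ⟨a, rfl⟩

theorem SolvesGeneralizedHJ.isTangentTo (hsol : SolvesGeneralizedHJ D s) : IsTangentTo D s := by
  intro u
  obtain ⟨γ, ⟨U, hU, hxU, hγ, hint⟩, hu⟩ := hsol.1 u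
  have hxU' : π u ∈ U := hxU rfl
  have h1 := le_tangentImage_of_isIntegralSection_toMap hxU'
    (hsol.2 U γ hU ⟨U, hU, subset_rfl, hγ, hint⟩)
    ((hγ.contMDiffAt (hU.mem_nhds hxU')).mdifferentiableAt (by simp))
  have h2 : ∀ v : E, v = u →
      D (s.toMap v) ≤ tangentImage 𝓘(ℝ, TotModel m n) (resModel m n) s.toMap v →
      D (s.toMap u) ≤ tangentImage 𝓘(ℝ, TotModel m n) (resModel m n) s.toMap u := by
    rintro v rfl h; exact h
  exact h2 _ hu h1

variable [IsManifold 𝓘(ℝ, BaseModel m) ∞ M]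

/-- An integral section which meets `Im s` stays in it, if the distribution is tangent to `Im s`. -/
theorem IsTangentTo.eventually_mem (hT : IsTangentTo D s) (hD : IsSmoothOfRank m D)
    (htr : IsTransverse 𝓘(ℝ, BaseModel m) (projBase m n π) D) {U : Set M} (hU : IsOpen U)
    {ψ : M → ResDual m n π} (hψ : ContMDiffOn 𝓘(ℝ, BaseModel m) (resModel m n) ∞ ψ U)
    (hint : ∀ x ∈ U, projBase m n π (ψ x) = x ∧
      tangentImage 𝓘(ℝ, BaseModel m) (resModel m n) ψ x = D (ψ x))
    {x : M} (hx : x ∈ U) (hxs : s.toMap (ψ x).proj = ψ x) :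
    ∀ᶠ y in 𝓝 x, s.toMap (ψ y).proj = ψ y :=
  eventually_mem_image_of_integralSection (by simp) (contMDiff_projBase π) hD htr
    (contMDiff_resDual_proj π) s.contMDiff_toMap (fun _ => rfl) hT hU hψ hint hx hxs

theorem IsTangentTo.isIntegrable_projectedDistribution (hT : IsTangentTo D s)
    (hD : IsSmoothOfRank m D) (htr : IsTransverse 𝓘(ℝ, BaseModel m) (projBase m n π) D)
    (hint : IsIntegrable 𝓘(ℝ, BaseModel m) (projBase m n π) D) :
    IsIntegrable 𝓘(ℝ, BaseModel m) π (projectedDistribution s D) := by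
  intro u
  obtain ⟨ψ, ⟨U, hU, hxU, hψ, hψint⟩, hψu⟩ := hint (s.toMap u)
  have hψu' : ψ (π u) = s.toMap u := hψu
  refine ⟨fun x => (ψ x).proj, isIntegralSection_proj hψ hψint
    (isOpen_setOf_mem_and_eq hU fun x hx => hT.eventually_mem hD htr hU hψ hψint hx)
    (sep_subset _ _) ?_ fun x hx => hx.2,
    congrArg Bundle.TotalSpace.proj hψu'⟩
  rintro x rfl
  exact ⟨hxU rfl, by rw [hψu']⟩

theorem IsTangentTo.boundarySectionsProjectOnto [T2Space E] (hT : IsTangentTo D s)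
    (hD : IsSmoothOfRank m D) (htr : IsTransverse 𝓘(ℝ, BaseModel m) (projBase m n π) D)
    (hint : IsIntegrable 𝓘(ℝ, BaseModel m) (projBase m n π) D) :
    BoundarySectionsProjectOnto D s := by
  have := t2Space_resDual (m := m) (n := n) π
  refine ⟨hT.isIntegrable_projectedDistribution hD htr hint, fun N hN => ⟨?_, fun γ hγ =>
    ⟨_, hT.isIntegralSection_toMap hγ, fun x _ => mem_range_self _, fun _ _ => rfl⟩⟩⟩
  rintro ψ ⟨U, hU, hNU, hψ, hψint⟩ hbd
  obtain ⟨x, hx⟩ := hN.boundary_nonempty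
  have hloc : ∀ x ∈ U, s.toMap (ψ x).proj = ψ x → ∀ᶠ y in 𝓝 x, s.toMap (ψ y).proj = ψ y :=
    fun x hx => hT.eventually_mem hD htr hU hψ hψint hx
  have hxs : s.toMap (ψ x).proj = ψ x := by
    obtain ⟨u, hu⟩ := hbd x hx
    rw [← hu]
  have hall := IsPreconnected.eqOn_of_eventuallyEq hN.connected.isPreconnected hU hNU
    ((s.contMDiff_toMap.comp (contMDiff_resDual_proj π)).continuous.comp_continuousOn
      hψ.continuousOn) hψ.continuousOn hloc hx.1 hxs
  exact isIntegralSection_proj hψ hψint (isOpen_setOf_mem_and_eq hU hloc) (sep_subset _ _)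
    (fun y hy => ⟨hNU hy, hall hy⟩) fun y hy => hy.2

theorem BoundarySectionsProjectOnto.isTangentTo [T2Space E] (hm : 1 ≤ m)
    (hb : BoundarySectionsProjectOnto D s)
    (hD : IsSmoothOfRank m D) (htr : IsTransverse 𝓘(ℝ, BaseModel m) (projBase m n π) D) :
    IsTangentTo D s := by
  intro u
  have := t2Space_resDual (m := m) (n := n) π
  have : Nonempty (Fin m) := ⟨⟨0, hm⟩⟩
  obtain ⟨γ, hγi, hu⟩ := hb.1 u
  have hγi' := hγi
  obtain ⟨U, hU, hxU, hγ, hγint⟩ := hγi'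
  have hxU' : π u ∈ U := hxU rfl
  set χ := extChartAt 𝓘(ℝ, BaseModel m) (π u) with hχ
  obtain ⟨r, hr, hrsub⟩ := Metric.nhds_basis_closedBall.mem_iff.1
    (Filter.inter_mem (extChartAt_target_mem_nhds (I := 𝓘(ℝ, BaseModel m)) (π u))
      ((continuousAt_extChartAt_symm (I := 𝓘(ℝ, BaseModel m)) (π u)).preimage_mem_nhds
        (hU.mem_nhds (by simpa using hxU'))))
  obtain ⟨e, he⟩ := exists_norm_eq (BaseModel m) zero_le_one
  -- the balls of radius `t` which touch the ball of radius `r` from inside at `z₁`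
  set z₁ := χ (π u) + r • e with hz₁
  let B : ℝ → Set (BaseModel m) := fun t => Metric.closedBall (χ (π u) + (r - t) • e) t
  have hz₁t : ∀ t, 0 < t → z₁ ∈ Metric.sphere (χ (π u) + (r - t) • e) t := by
    intro t ht
    rw [mem_sphere_iff_norm, hz₁, add_sub_add_left_eq_sub, ← sub_smul, sub_sub_cancel, norm_smul,
      he, mul_one, Real.norm_of_nonneg ht.le]
  have hBr : ∀ t, t ≤ r → B t ⊆ Metric.closedBall (χ (π u)) r := by
    intro t ht
    refine Metric.closedBall_subset_closedBall' ?_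
    rw [dist_eq_norm, add_sub_cancel_left, norm_smul, he, mul_one,
      Real.norm_of_nonneg (sub_nonneg.2 ht)]
    linarith
  have hex : ∀ t, 0 < t → t ≤ r → ∃ ψ : M → ResDual m n π,
      IsIntegralSection 𝓘(ℝ, BaseModel m) (projBase m n π) D (χ.symm '' B t) ψ ∧
      ∀ z ∈ Metric.sphere (χ (π u) + (r - t) • e) t, ψ (χ.symm z) = s.toMap (γ (χ.symm z)) := by
    intro t ht htr'
    have hsub : B t ⊆ χ.target := fun z hz => (hrsub (hBr t htr' hz)).1
    obtain ⟨ψ, hψ, hψb, hψγ⟩ := (hb.2 _ (isDomainWithBoundary_image_closedBall ht hsub)).2 γ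
      ⟨U, hU, by rintro _ ⟨z, hz, rfl⟩; exact (hrsub (hBr t htr' hz)).2, hγ, hγint⟩
    refine ⟨ψ, hψ, fun z hz => ?_⟩
    obtain ⟨v, hv⟩ := hψb (χ.symm z) (by
      rw [boundary_image_closedBall ht hsub]
      exact mem_image_of_mem _ hz)
    have h1 := hψγ (χ.symm z) (mem_image_of_mem _ (Metric.sphere_subset_closedBall hz))
    rw [← hv] at h1 ⊢
    rw [← h1]
  obtain ⟨ψ, hψi, hψs⟩ := hex r hr le_rfl
  have hkey : ∀ z ∈ Metric.ball (χ (π u)) r, ψ (χ.symm z) = s.toMap (γ (χ.symm z)) := by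
    intro z hz
    have hne : z ≠ χ (π u) + r • e := by
      rintro rfl
      rw [mem_ball_iff_norm, add_sub_cancel_left, norm_smul, he, mul_one,
        Real.norm_of_nonneg hr.le] at hz
      exact lt_irrefl _ hz
    obtain ⟨t, ht, htr', hzt⟩ := exists_mem_sphere_of_mem_ball hr.le hz hne
    obtain ⟨ψ', hψ'i, hψ's⟩ := hex t ht htr'
    rw [← hψ's z hzt]
    obtain ⟨U₁, hU₁, hBU₁, hψ₁, hint₁⟩ := hψi
    obtain ⟨U₂, hU₂, hBU₂, hψ₂, hint₂⟩ := hψ'i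
    have hBt : χ.symm '' B t ⊆ χ.symm '' B r := by
      refine image_mono ((hBr t htr').trans ?_)
      simp [B]
    refine IsPreconnected.eqOn_of_eventuallyEq (N := χ.symm '' B t) (U := U₁ ∩ U₂) ?_
      (hU₁.inter hU₂) (subset_inter (hBt.trans hBU₁) hBU₂)
      (hψ₁.continuousOn.mono inter_subset_left) (hψ₂.continuousOn.mono inter_subset_right)
      (fun x hx hxe => eventuallyEq_of_integralSection (by simp) (contMDiff_projBase π) hD htr
        hU₁ hU₂ hψ₁ hψ₂ hint₁ hint₂ hx.1 hx.2 hxe)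
      (mem_image_of_mem χ.symm (Metric.sphere_subset_closedBall (hz₁t t ht)))
      ((hψs z₁ (hz₁t r hr)).trans (hψ's z₁ (hz₁t t ht)).symm)
      (mem_image_of_mem χ.symm (Metric.sphere_subset_closedBall hzt))
    exact (convex_closedBall _ _).isPreconnected.image _ ((continuousOn_extChartAt_symm (π u)).mono
      fun w hw => (hrsub (hBr t htr' hw)).1)
  let W : Set M := χ.source ∩ χ ⁻¹' Metric.ball (χ (π u)) r
  have hW : IsOpen W := (continuousOn_extChartAt (π u)).isOpen_inter_preimage
    (isOpen_extChartAt_source (π u)) Metric.isOpen_ball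
  have hxW : π u ∈ W := ⟨mem_extChartAt_source _, Metric.mem_ball_self hr⟩
  have hWB : W ⊆ χ.symm '' B r := by
    rintro x ⟨hx, hx'⟩
    refine ⟨χ x, ?_, χ.left_inv hx⟩
    simpa [B] using Metric.ball_subset_closedBall hx'
  have h1 := le_tangentImage_of_isIntegralSection_toMap hxW
    ((hψi.mono hWB).congr hW (τ := fun x => s.toMap (γ x)) (by
      rintro x ⟨hx, hx'⟩
      have := hkey (χ x) hx'
      rw [χ.left_inv hx] at this
      exact this.symm))
    ((hγ.contMDiffAt (hU.mem_nhds hxU')).mdifferentiableAt (by simp))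
  have h2 : ∀ v : E, v = u →
      D (s.toMap v) ≤ tangentImage 𝓘(ℝ, TotModel m n) (resModel m n) s.toMap v →
      D (s.toMap u) ≤ tangentImage 𝓘(ℝ, TotModel m n) (resModel m n) s.toMap u := by
    rintro v rfl h; exact h
  exact h2 _ hu h1

end HamiltonJacobi

end HJ

theorem mainTheorem5 {m n : ℕ} (hm : 1 ≤ m)
    {M E : Type*}
    [TopologicalSpace M] [T2Space M] [SecondCountableTopology M]
    [ChartedSpace (HJ.BaseModel m) M] [IsManifold 𝓘(ℝ, HJ.BaseModel m) ∞ M]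
    [TopologicalSpace E] [T2Space E] [SecondCountableTopology E]
    [ChartedSpace (HJ.TotModel m n) E] [IsManifold 𝓘(ℝ, HJ.TotModel m n) ∞ E]
    (π : E → M) [HJ.FibredManifold m n π]
    (h : HJ.ResDual m n π → HJ.ExtDual m n π) (hh : HJ.IsHamiltonianSection m n π h)
    (D : HJ.Distribution (HJ.resModel m n) (HJ.ResDual m n π))
    (hD : HJ.IsHamiltonianDistribution m n π h D)
    (s : HJ.DualSection m n π)
    (hs : HJ.pullback 𝓘(ℝ, HJ.TotModel m n) (HJ.resModel m n) s.toMap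
      (HJ.hamiltonCartan m n π h) = 0) :
    List.TFAE [
      HJ.SolvesHJ h D s,
      HJ.IsLagrangianImage 𝓘(ℝ, HJ.TotModel m n) (HJ.resModel m n)
        (HJ.hamiltonCartan m n π h) s.toMap ∧ HJ.IsTangentTo D s,
      HJ.BoundarySectionsProjectOnto D s] := by
  have hLag := HJ.isLagrangianImage_of_pullback_eq_zero hh hs
  tfae_have 1 → 2 := fun h1 => ⟨hLag, h1.1.isTangentTo⟩
  tfae_have 2 → 1 := fun h2 =>
    ⟨⟨h2.2.isIntegrable_projectedDistribution hD.smooth hD.transverse hD.integrable,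
      fun _ _ _ hγ => h2.2.isIntegralSection_toMap hγ⟩, hs⟩
  tfae_have 2 → 3 := fun h2 =>
    h2.2.boundarySectionsProjectOnto hD.smooth hD.transverse hD.integrable
  tfae_have 3 → 2 := fun h3 => ⟨hLag, h3.isTangentTo hm hD.smooth hD.transverse⟩
  tfae_finish
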